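/- Work in the category of symmetric spectra (of simplicial sets), with "equivalence" meaning stable equivalence, and write $X\simeq Y$ if $X$ and $Y$ are connected by a zigzag of stable equivalences. Let $M$ be a (strictly) commutative square of symmetric spectra with maps $$\alpha:M_{00}\to M_{01},\quad \beta:M_{00}\to M_{10},\quad \gamma:M_{10}\to M_{11},\quad \delta:M_{01}\to M_{11},\qquad \gamma\beta=\delta\alpha .$$ Suppose there exists a map of symmetric spectra $s:M_{11}\to M_{10}$ such that $\gamma s=\mathrm{Id}_{M_{11}}$ and such that the map $\beta\vee s:M_{00}\vee M_{11}\to M_{10}$, given by $\beta$ on the first and by $s$ on the second wedge summand, is an equivalence. Let $C_2M$ be the $2$-cofiber (total cofiber) of the square, i.e. the homotopy cofiber of the map from the homotopy cofiber of $\beta$ to the homotopy cofiber of $\delta$ induced by $\alpha$ and $\gamma$. Then $$C_2 M\simeq \Sigma M_{01}.$$ -/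

import Mathlib

open CategoryTheory MonoidalCategory

universe u

noncomputable section

/-! ### Weak equivalences of simplicial sets -/

namespace SSet

/-- The standard simplex `Δ[1]`. -/
abbrev Δ1 : SSet.{u} := stdSimplex.obj (SimplexCategory.mk 1)

/-- Homotopy classes of maps `X ⟶ Z`, i.e. `π₀` of the mapping space: maps modulo the equivalence
relation generated by simplicial homotopies `X × Δ[1] ⟶ Z`. -/
def HoClass (X Z : SSet.{u}) : Type u :=
  Quot (fun f g : X ⟶ Z => Nonempty (Homotopy f g))

/-- Precomposition with `f` on homotopy classes. -/
def HoClass.precomp {X Y : SSet.{u}} (f : X ⟶ Y) (Z : SSet.{u}) : HoClass Y Z → HoClass X Z :=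
  Quot.lift (fun g => Quot.mk _ (f ≫ g)) (by
    rintro g g' ⟨H⟩
    exact Quot.sound ⟨{ h := (f ▷ Δ1) ≫ H.h
                        h₀ := by
                          rw [ι₀_comp_assoc, Homotopy.h₀]
                          rfl
                        h₁ := by
                          rw [ι₁_comp_assoc, Homotopy.h₁]
                          rfl
                        rel := by
                          ext _ ⟨⟨_, hx⟩, _⟩
                          exact hx.elim }⟩)

/-- A map of simplicial sets is a weak equivalence if it induces a bijection on homotopy classes of
maps into every Kan complex. -/
def IsWeakEquiv {X Y : SSet.{u}} (f : X ⟶ Y) : Prop :=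
  ∀ Z : SSet.{u}, KanComplex Z → Function.Bijective (HoClass.precomp f Z)

end SSet

/-! ### Pointed simplicial sets -/

/-- A pointed simplicial set: `pt k` is the base point, seen as a degenerate simplex of each
dimension. -/
structure PSSet where
  toSSet : SSet.{u}
  pt : ∀ k : SimplexCategoryᵒᵖ, toSSet.obj k
  map_pt : ∀ {k l : SimplexCategoryᵒᵖ} (θ : k ⟶ l), toSSet.map θ (pt k) = pt l

namespace PSSet

attribute [simp] map_pt

/-- The set of `k`-simplices. -/
abbrev S (X : PSSet.{u}) (k : SimplexCategoryᵒᵖ) : Type u := X.toSSet.obj k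

/-- Base point preserving maps of pointed simplicial sets. -/
@[ext]
structure Hom (X Y : PSSet.{u}) where
  hom : X.toSSet ⟶ Y.toSSet
  app_pt : ∀ k, hom.app k (X.pt k) = Y.pt k

attribute [simp] Hom.app_pt

instance : Category PSSet.{u} where
  Hom X Y := Hom X Y
  id X := ⟨𝟙 _, fun _ => rfl⟩
  comp f g := ⟨f.hom ≫ g.hom, fun k => by simp⟩

/-- The effect of a map on `k`-simplices. -/
abbrev Hom.ap {X Y : PSSet.{u}} (f : X ⟶ Y) (k : SimplexCategoryᵒᵖ) (x : X.S k) : Y.S k :=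
  Hom.hom f |>.app k x

/-- A map of pointed simplicial sets from its values on simplices. -/
def homMk {X Y : PSSet.{u}} (f : ∀ k, X.S k → Y.S k)
    (nat : ∀ {k l : SimplexCategoryᵒᵖ} (θ : k ⟶ l) (x : X.S k),
      f l (X.toSSet.map θ x) = Y.toSSet.map θ (f k x))
    (hpt : ∀ k, f k (X.pt k) = Y.pt k) : X ⟶ Y where
  hom := { app := fun k => ↾(f k)
           naturality := fun k l θ => by
             ext x
             exact nat θ x }
  app_pt := hpt

/-- The constant simplices of `Δ[1]` are preserved by the simplicial operators. -/
theorem map_const (i : Fin 2) {k l : SimplexCategoryᵒᵖ} (θ : k ⟶ l) :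
    SSet.Δ1.{u}.map θ (SSet.stdSimplex.const 1 i k) = SSet.stdSimplex.const 1 i l := rfl

/-- The circle `S¹ = Δ[1] / ∂Δ[1]`. -/
def circle : PSSet.{u} where
  toSSet :=
    { obj := fun k => Quot (fun s t : SSet.Δ1.{u}.obj k =>
        s ∈ (SSet.boundary.{u} 1).obj k ∧
          t ∈ (SSet.boundary.{u} 1).obj k)
      map := fun θ => ↾(Quot.map (SSet.Δ1.{u}.map θ)
        (fun _ _ h => ⟨(SSet.boundary.{u} 1).map θ h.1,
          (SSet.boundary.{u} 1).map θ h.2⟩))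
      map_id := fun k => by
        ext ⟨x⟩
        exact congrArg (Quot.mk _) (by simp)
      map_comp := fun f g => by
        ext ⟨x⟩
        exact congrArg (Quot.mk _) (by simp) }
  pt k := Quot.mk _ (SSet.stdSimplex.const 1 0 k)
  map_pt _ := rfl

/-- The interval `Δ[1]`, with the vertex `1` as base point. -/
def interval : PSSet.{u} where
  toSSet := SSet.Δ1
  pt k := SSet.stdSimplex.const 1 1 k
  map_pt _ := rfl

/-- `K₊`: the simplicial set `K` with a disjoint base point. -/
def plus (K : SSet.{u}) : PSSet.{u} where
  toSSet :=
    { obj := fun k => Option (K.obj k)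
      map := fun θ => ↾(Option.map (K.map θ))
      map_id := fun k => by
        ext x
        cases x <;> simp
      map_comp := fun f g => by
        ext x
        cases x <;> simp }
  pt _ := none
  map_pt _ := rfl

/-- The relation on `X × K` that collapses the two axes. -/
inductive SmashRel (X K : PSSet.{u}) (k : SimplexCategoryᵒᵖ) : X.S k × K.S k → X.S k × K.S k → Prop
  | left (a : K.S k) : SmashRel X K k (X.pt k, a) (X.pt k, K.pt k)
  | right (x : X.S k) : SmashRel X K k (x, K.pt k) (X.pt k, K.pt k)

/-- The smash product `X ∧ K` of pointed simplicial sets. -/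
def smash (X K : PSSet.{u}) : PSSet.{u} where
  toSSet :=
    { obj := fun k => Quot (SmashRel X K k)
      map := fun {k l} θ => ↾(Quot.map (fun p => (X.toSSet.map θ p.1, K.toSSet.map θ p.2)) (by
        rintro _ _ (a | x)
        · simpa using SmashRel.left (X := X) (K.toSSet.map θ a)
        · simpa using SmashRel.right (K := K) (X.toSSet.map θ x)))
      map_id := fun k => by
        ext ⟨x⟩
        exact congrArg (Quot.mk _) (by simp)
      map_comp := fun f g => by
        ext ⟨x⟩
        exact congrArg (Quot.mk _) (by simp) }
  pt k := Quot.mk _ (X.pt k, K.pt k)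
  map_pt θ := congrArg (Quot.mk _) (by simp)

/-- The simplex `x ∧ a` of `X ∧ K`. -/
def smash.mk {X K : PSSet.{u}} {k : SimplexCategoryᵒᵖ} (x : X.S k) (a : K.S k) : (smash X K).S k :=
  Quot.mk _ (x, a)

@[simp]
theorem smash.mk_pt_left {X K : PSSet.{u}} {k : SimplexCategoryᵒᵖ} (a : K.S k) :
    smash.mk (X.pt k) a = (smash X K).pt k := Quot.sound (.left a)

@[simp]
theorem smash.mk_pt_right {X K : PSSet.{u}} {k : SimplexCategoryᵒᵖ} (x : X.S k) :
    smash.mk x (K.pt k) = (smash X K).pt k := Quot.sound (.right x)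

/-- A function out of `X ∧ K` in dimension `k`. -/
def smash.lift {X K : PSSet.{u}} {k : SimplexCategoryᵒᵖ} {T : Type u} (f : X.S k → K.S k → T) (b : T)
    (hl : ∀ a, f (X.pt k) a = b) (hr : ∀ x, f x (K.pt k) = b) : (smash X K).S k → T :=
  Quot.lift (fun p => f p.1 p.2) (by
    rintro _ _ (a | x)
    · exact (hl a).trans (hl _).symm
    · exact (hr x).trans (hr _).symm)

/-- The map `f ∧ K : X ∧ K ⟶ Y ∧ K`. -/
def smash.map {X Y : PSSet.{u}} (f : X ⟶ Y) (K : PSSet.{u}) : smash X K ⟶ smash Y K :=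
  homMk (fun k => smash.lift (fun x a => smash.mk (Hom.ap f k x) a) ((smash Y K).pt k)
      (fun a => by simp) (fun x => by simp))
    (by
      rintro k l θ ⟨x, a⟩
      exact congrArg (fun y => smash.mk y _) (NatTrans.naturality_apply (Hom.hom f) θ x))
    (fun k => by
      exact congrArg (fun y => smash.mk y _) (Hom.app_pt f k))

/-- The relation `f a ∼ g a` on `Y ⊔ Z`, for `f : A ⟶ Y` and `g : A ⟶ Z`. -/
inductive GlueRel {A Y Z : PSSet.{u}} (f : A ⟶ Y) (g : A ⟶ Z) (k : SimplexCategoryᵒᵖ) :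
    Y.S k ⊕ Z.S k → Y.S k ⊕ Z.S k → Prop
  | glue (a : A.S k) : GlueRel f g k (.inl (Hom.ap f k a)) (.inr (Hom.ap g k a))

/-- The pushout `Y ∪_A Z` of pointed simplicial sets. -/
def glue {A Y Z : PSSet.{u}} (f : A ⟶ Y) (g : A ⟶ Z) : PSSet.{u} where
  toSSet :=
    { obj := fun k => Quot (GlueRel f g k)
      map := fun {k l} θ => ↾(Quot.map (Sum.map (Y.toSSet.map θ) (Z.toSSet.map θ)) (by
        rintro _ _ ⟨a⟩
        have := GlueRel.glue (f := f) (g := g) (A.toSSet.map θ a)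
        rw [Hom.ap, Hom.ap, NatTrans.naturality_apply, NatTrans.naturality_apply] at this
        exact this))
      map_id := fun k => by
        ext ⟨x | x⟩ <;> exact congrArg (Quot.mk _) (by simp)
      map_comp := fun f g => by
        ext ⟨x | x⟩ <;> exact congrArg (Quot.mk _) (by simp) }
  pt k := Quot.mk _ (.inl (Y.pt k))
  map_pt θ := congrArg (Quot.mk _) (by simp)

section

variable {A Y Z : PSSet.{u}} (f : A ⟶ Y) (g : A ⟶ Z)

/-- The inclusion of `Y` in `Y ∪_A Z`. -/
def glue.inl : Y ⟶ glue f g :=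
  homMk (fun _ y => Quot.mk _ (.inl y)) (fun _ _ => rfl) (fun _ => rfl)

/-- The inclusion of `Z` in `Y ∪_A Z`. -/
def glue.inr : Z ⟶ glue f g :=
  homMk (fun _ z => Quot.mk _ (.inr z)) (fun _ _ => rfl) (fun k => by
    have := Quot.sound (GlueRel.glue (f := f) (g := g) (A.pt k))
    rw [Hom.ap, Hom.ap, Hom.app_pt, Hom.app_pt] at this
    exact this.symm)

variable {f g}

theorem glue.condition (k : SimplexCategoryᵒᵖ) (a : A.S k) :
    Hom.ap (glue.inl f g) k (Hom.ap f k a) = Hom.ap (glue.inr f g) k (Hom.ap g k a) :=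
  Quot.sound (.glue a)

/-- The map `Y ∪_A Z ⟶ T` determined by maps on `Y` and `Z` that agree on `A`. -/
def glue.desc {T : PSSet.{u}} (p : Y ⟶ T) (q : Z ⟶ T)
    (h : ∀ k a, Hom.ap p k (Hom.ap f k a) = Hom.ap q k (Hom.ap g k a)) : glue f g ⟶ T :=
  homMk (fun k => Quot.lift (Sum.elim (Hom.ap p k) (Hom.ap q k)) (by
      rintro _ _ ⟨a⟩
      exact h k a))
    (by
      rintro k l θ ⟨y | z⟩
      · exact NatTrans.naturality_apply (Hom.hom p) θ y
      · exact NatTrans.naturality_apply (Hom.hom q) θ z)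
    (fun k => Hom.app_pt p k)

end

/-- The pointed mapping space `Map_*(S¹, Y)`, as a subcomplex of the internal hom of simplicial
sets: a `k`-simplex is a map `S¹ × Δ[k] ⟶ Y` that is constant on `* × Δ[k]`. -/
def loops (Y : PSSet.{u}) : ((ihom circle.{u}.toSSet).obj Y.toSSet).Subcomplex where
  obj k := {a | ∀ (l : SimplexCategoryᵒᵖ) (θ : k ⟶ l), a.app l θ (circle.pt l) = Y.pt l}
  map := by
    intro k l θ a ha m η
    exact ha m (θ ≫ η)

end PSSet

/-! ### Symmetric spectra -/

/-- The iterate `Aₙ × T^p → Aₙ₊ₚ` of maps `Aₙ × T → Aₙ₊₁`. -/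
def iterSusp {A : ℕ → Type u} {T : Type u} (σ : ∀ n, A n → T → A (n + 1)) (n : ℕ) :
    ∀ p : ℕ, A n → (Fin p → T) → A (n + p)
  | 0, x, _ => x
  | p + 1, x, t => σ (n + p) (iterSusp σ n p x (fun i => t i.castSucc)) (t (Fin.last p))

/-- The block permutation `π × τ ∈ Σₙ × Σₚ ⊆ Σₙ₊ₚ`. -/
def blockPerm {n p : ℕ} (π : Equiv.Perm (Fin n)) (τ : Equiv.Perm (Fin p)) :
    Equiv.Perm (Fin (n + p)) :=
  finSumFinEquiv.permCongr (Equiv.Perm.sumCongr π τ)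

/-- A symmetric spectrum (of simplicial sets): a sequence of pointed simplicial sets `Xₙ` with a
left action of the symmetric group `Σₙ`, and pointed structure maps `Xₙ ∧ S¹ ⟶ Xₙ₊₁`, given here as
natural maps `Xₙ × S¹ → Xₙ₊₁` that collapse both axes, such that the iterated structure maps
`Xₙ ∧ (S¹)^{∧p} ⟶ Xₙ₊ₚ` are `Σₙ × Σₚ`-equivariant. -/
structure SymSpec where
  lvl : ℕ → PSSet.{u}
  act : ∀ n : ℕ, Equiv.Perm (Fin n) → (lvl n ⟶ lvl n)
  act_one : ∀ n k (x : (lvl n).S k), PSSet.Hom.ap (act n 1) k x = x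
  act_mul : ∀ n (π τ : Equiv.Perm (Fin n)) k (x : (lvl n).S k),
    PSSet.Hom.ap (act n (π * τ)) k x = PSSet.Hom.ap (act n π) k (PSSet.Hom.ap (act n τ) k x)
  susp : ∀ (k : SimplexCategoryᵒᵖ) (n : ℕ), (lvl n).S k → PSSet.circle.{u}.S k → (lvl (n + 1)).S k
  susp_pt_left : ∀ k n t, susp k n ((lvl n).pt k) t = (lvl (n + 1)).pt k
  susp_pt_right : ∀ k n x, susp k n x (PSSet.circle.pt k) = (lvl (n + 1)).pt k
  susp_nat : ∀ {k l : SimplexCategoryᵒᵖ} (θ : k ⟶ l) n x t,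
    susp l n ((lvl n).toSSet.map θ x) (PSSet.circle.toSSet.map θ t) =
      (lvl (n + 1)).toSSet.map θ (susp k n x t)
  susp_equivariant : ∀ k n p (π : Equiv.Perm (Fin n)) (τ : Equiv.Perm (Fin p)) (x : (lvl n).S k)
    (t : Fin p → PSSet.circle.S k),
    iterSusp (A := fun m => (lvl m).S k) (susp k) n p (PSSet.Hom.ap (act n π) k x)
        (fun i => t (τ⁻¹ i)) =
      PSSet.Hom.ap (act (n + p) (blockPerm π τ)) k
        (iterSusp (A := fun m => (lvl m).S k) (susp k) n p x t)

namespace SymSpec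

open PSSet

attribute [simp] act_one susp_pt_left susp_pt_right

/-- Morphisms of symmetric spectra: equivariant pointed maps `Xₙ ⟶ Yₙ` compatible with the
structure maps. -/
@[ext]
structure Hom (X Y : SymSpec.{u}) where
  lvl : ∀ n, X.lvl n ⟶ Y.lvl n
  lvl_act : ∀ n π k x, PSSet.Hom.ap (lvl n) k (PSSet.Hom.ap (X.act n π) k x) =
    PSSet.Hom.ap (Y.act n π) k (PSSet.Hom.ap (lvl n) k x)
  lvl_susp : ∀ k n x t, PSSet.Hom.ap (lvl (n + 1)) k (X.susp k n x t) =
    Y.susp k n (PSSet.Hom.ap (lvl n) k x) t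

instance : Category SymSpec.{u} where
  Hom X Y := Hom X Y
  id X := ⟨fun n => 𝟙 _, fun _ _ _ _ => rfl, fun _ _ _ _ => rfl⟩
  comp f g := ⟨fun n => f.lvl n ≫ g.lvl n,
    fun n π k x => (congrArg (PSSet.Hom.ap (g.lvl n) k) (f.lvl_act n π k x)).trans
      (g.lvl_act n π k _),
    fun k n x t => (congrArg (PSSet.Hom.ap (g.lvl (n + 1)) k) (f.lvl_susp k n x t)).trans
      (g.lvl_susp k n _ t)⟩

/-- The effect of a map of symmetric spectra on the `k`-simplices of level `n`. -/
abbrev ap {X Y : SymSpec.{u}} (f : X ⟶ Y) (n : ℕ) (k : SimplexCategoryᵒᵖ) (x : (X.lvl n).S k) :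
    (Y.lvl n).S k :=
  PSSet.Hom.ap (Hom.lvl f n) k x

/-- Maps that commute with the structure maps commute with their iterates. -/
theorem iterSusp_map {A B : ℕ → Type u} {T : Type u} {σ : ∀ n, A n → T → A (n + 1)}
    {τ : ∀ n, B n → T → B (n + 1)} (φ : ∀ n, A n → B n)
    (h : ∀ n x t, φ (n + 1) (σ n x t) = τ n (φ n x) t) (n p : ℕ) (x : A n) (t : Fin p → T) :
    φ (n + p) (iterSusp σ n p x t) = iterSusp τ n p (φ n x) t := by
  induction p with
  | zero => rfl
  | succ p ih => exact (h _ _ _).trans (congrArg (fun y => τ (n + p) y _) (ih _))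

/-- The symmetric spectrum `X ∧ K`, with levels `Xₙ ∧ K`. -/
def smash (X : SymSpec.{u}) (K : PSSet.{u}) : SymSpec.{u} where
  lvl n := PSSet.smash (X.lvl n) K
  act n π := PSSet.smash.map (X.act n π) K
  act_one := by
    rintro n k ⟨x, a⟩
    exact congrArg (fun y => smash.mk y a) (X.act_one n k x)
  act_mul := by
    rintro n π τ k ⟨x, a⟩
    exact congrArg (fun y => smash.mk y a) (X.act_mul n π τ k x)
  susp k n z t := PSSet.smash.lift (fun x a => smash.mk (X.susp k n x t) a)
    ((PSSet.smash (X.lvl (n + 1)) K).pt k) (by simp) (by simp) z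
  susp_pt_left k n t := congrArg (fun y => smash.mk y _) (X.susp_pt_left k n t) |>.trans (by simp)
  susp_pt_right := by
    rintro k n ⟨x, a⟩
    exact congrArg (fun y => smash.mk y a) (X.susp_pt_right k n x) |>.trans (by simp)
  susp_nat := by
    rintro k l θ n ⟨x, a⟩ t
    exact congrArg (fun y => smash.mk y _) (X.susp_nat θ n x t)
  susp_equivariant := by
    rintro k n p π τ ⟨x, a⟩ t
    refine (iterSusp_map (A := fun m => (X.lvl m).S k) (σ := X.susp k)
      (fun m (y : (X.lvl m).S k) => smash.mk y a) (fun _ _ _ => rfl) n p _ _).symm.trans ?_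
    refine (congrArg (fun y => smash.mk y a) (X.susp_equivariant k n p π τ x t)).trans ?_
    exact congrArg (PSSet.Hom.ap (PSSet.smash.map (X.act (n + p) (blockPerm π τ)) K) k)
      (iterSusp_map (A := fun m => (X.lvl m).S k) (σ := X.susp k)
        (fun m (y : (X.lvl m).S k) => smash.mk y a) (fun _ _ _ => rfl) n p x t)

/-- The map `f ∧ K`. -/
def smashMap {X Y : SymSpec.{u}} (f : X ⟶ Y) (K : PSSet.{u}) : X.smash K ⟶ Y.smash K where
  lvl n := PSSet.smash.map (Hom.lvl f n) K
  lvl_act := by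
    rintro n π k ⟨x, a⟩
    exact congrArg (fun y => smash.mk y a) (Hom.lvl_act f n π k x)
  lvl_susp := by
    rintro k n ⟨x, a⟩ t
    exact congrArg (fun y => smash.mk y a) (Hom.lvl_susp f k n x t)

/-- The inclusion `x ↦ x ∧ a` of `X` in `X ∧ K` at a vertex `a` of `K`, given as a compatible family
of (degenerate) simplices. -/
def inclAt (X : SymSpec.{u}) (K : PSSet.{u}) (a : ∀ k, K.S k)
    (ha : ∀ {k l : SimplexCategoryᵒᵖ} (θ : k ⟶ l), K.toSSet.map θ (a k) = a l) :
    X ⟶ X.smash K where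
  lvl _ := homMk (fun k x => smash.mk x (a k))
    (fun θ _ => congrArg (fun b => smash.mk _ b) (ha θ).symm) (fun _ => smash.mk_pt_left _)
  lvl_act _ _ _ _ := rfl
  lvl_susp _ _ _ _ := rfl

/-- The action of the symmetric groups on the pushout of symmetric spectra. -/
def glueAct {A Y Z : SymSpec.{u}} (f : A ⟶ Y) (g : A ⟶ Z) (n : ℕ) (π : Equiv.Perm (Fin n)) :
    PSSet.glue (Hom.lvl f n) (Hom.lvl g n) ⟶ PSSet.glue (Hom.lvl f n) (Hom.lvl g n) :=
  PSSet.glue.desc (Y.act n π ≫ PSSet.glue.inl _ _) (Z.act n π ≫ PSSet.glue.inr _ _) (by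
    intro k a
    refine (congrArg (PSSet.Hom.ap (PSSet.glue.inl _ _) k) (Hom.lvl_act f n π k a)).symm.trans ?_
    refine (PSSet.glue.condition k _).trans ?_
    exact congrArg (PSSet.Hom.ap (PSSet.glue.inr _ _) k) (Hom.lvl_act g n π k a))

/-- The structure maps of the pushout of symmetric spectra. -/
def glueSusp {A Y Z : SymSpec.{u}} (f : A ⟶ Y) (g : A ⟶ Z) (k : SimplexCategoryᵒᵖ) (n : ℕ)
    (w : (PSSet.glue (Hom.lvl f n) (Hom.lvl g n)).S k) (t : circle.{u}.S k) :
    (PSSet.glue (Hom.lvl f (n + 1)) (Hom.lvl g (n + 1))).S k :=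
  Quot.lift
    (Sum.elim (fun y => PSSet.Hom.ap (PSSet.glue.inl (Hom.lvl f (n + 1)) (Hom.lvl g (n + 1))) k
        (Y.susp k n y t))
      (fun z => PSSet.Hom.ap (PSSet.glue.inr (Hom.lvl f (n + 1)) (Hom.lvl g (n + 1))) k
        (Z.susp k n z t))) (by
      rintro _ _ ⟨a⟩
      refine (congrArg (PSSet.Hom.ap (PSSet.glue.inl _ _) k)
        (Hom.lvl_susp f k n a t)).symm.trans ?_
      refine (PSSet.glue.condition k _).trans ?_
      exact congrArg (PSSet.Hom.ap (PSSet.glue.inr _ _) k) (Hom.lvl_susp g k n a t)) w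

/-- The pushout `Y ∪_A Z` of symmetric spectra, formed levelwise. -/
def glue {A Y Z : SymSpec.{u}} (f : A ⟶ Y) (g : A ⟶ Z) : SymSpec.{u} where
  lvl n := PSSet.glue (Hom.lvl f n) (Hom.lvl g n)
  act := glueAct f g
  act_one := by
    rintro n k ⟨y | z⟩
    · exact congrArg (PSSet.Hom.ap (PSSet.glue.inl _ _) k) (Y.act_one n k y)
    · exact congrArg (PSSet.Hom.ap (PSSet.glue.inr _ _) k) (Z.act_one n k z)
  act_mul := by
    rintro n π τ k ⟨y | z⟩
    · exact congrArg (PSSet.Hom.ap (PSSet.glue.inl _ _) k) (Y.act_mul n π τ k y)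
    · exact congrArg (PSSet.Hom.ap (PSSet.glue.inr _ _) k) (Z.act_mul n π τ k z)
  susp := glueSusp f g
  susp_pt_left k n t := congrArg (PSSet.Hom.ap (PSSet.glue.inl _ _) k) (Y.susp_pt_left k n t)
  susp_pt_right := by
    rintro k n ⟨y | z⟩
    · exact congrArg (PSSet.Hom.ap (PSSet.glue.inl _ _) k) (Y.susp_pt_right k n y)
    · exact (congrArg (PSSet.Hom.ap (PSSet.glue.inr _ _) k) (Z.susp_pt_right k n z)).trans
        (PSSet.Hom.app_pt _ k)
  susp_nat := by
    rintro k l θ n ⟨y | z⟩ t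
    · exact congrArg (PSSet.Hom.ap (PSSet.glue.inl _ _) l) (Y.susp_nat θ n y t)
    · exact congrArg (PSSet.Hom.ap (PSSet.glue.inr _ _) l) (Z.susp_nat θ n z t)
  susp_equivariant := by
    rintro k n p π τ ⟨y | z⟩ t
    · refine (iterSusp_map (A := fun m => (Y.lvl m).S k) (σ := Y.susp k)
        (τ := glueSusp f g k) (fun m => PSSet.Hom.ap (PSSet.glue.inl (Hom.lvl f m) (Hom.lvl g m)) k)
        (fun _ _ _ => rfl) n p _ _).symm.trans ?_
      refine (congrArg (PSSet.Hom.ap (PSSet.glue.inl _ _) k)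
        (Y.susp_equivariant k n p π τ y t)).trans ?_
      exact congrArg (PSSet.Hom.ap (glueAct f g (n + p) (blockPerm π τ)) k)
        (iterSusp_map (A := fun m => (Y.lvl m).S k)
        (σ := Y.susp k) (τ := glueSusp f g k)
        (fun m => PSSet.Hom.ap (PSSet.glue.inl (Hom.lvl f m) (Hom.lvl g m)) k)
        (fun _ _ _ => rfl) n p y t)
    · refine (iterSusp_map (A := fun m => (Z.lvl m).S k) (σ := Z.susp k)
        (τ := glueSusp f g k) (fun m => PSSet.Hom.ap (PSSet.glue.inr (Hom.lvl f m) (Hom.lvl g m)) k)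
        (fun _ _ _ => rfl) n p _ _).symm.trans ?_
      refine (congrArg (PSSet.Hom.ap (PSSet.glue.inr _ _) k)
        (Z.susp_equivariant k n p π τ z t)).trans ?_
      exact congrArg (PSSet.Hom.ap (glueAct f g (n + p) (blockPerm π τ)) k)
        (iterSusp_map (A := fun m => (Z.lvl m).S k)
        (σ := Z.susp k) (τ := glueSusp f g k)
        (fun m => PSSet.Hom.ap (PSSet.glue.inr (Hom.lvl f m) (Hom.lvl g m)) k)
        (fun _ _ _ => rfl) n p z t)

section

variable {A Y Z : SymSpec.{u}} (f : A ⟶ Y) (g : A ⟶ Z)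

/-- The inclusion of `Y` in `Y ∪_A Z`. -/
def glue.inl : Y ⟶ glue f g where
  lvl _ := PSSet.glue.inl _ _
  lvl_act _ _ _ _ := rfl
  lvl_susp _ _ _ _ := rfl

/-- The inclusion of `Z` in `Y ∪_A Z`. -/
def glue.inr : Z ⟶ glue f g where
  lvl _ := PSSet.glue.inr _ _
  lvl_act _ _ _ _ := rfl
  lvl_susp _ _ _ _ := rfl

theorem glue.condition : f ≫ glue.inl f g = g ≫ glue.inr f g := by
  refine Hom.ext (funext fun n => PSSet.Hom.ext (NatTrans.ext (funext fun k => ?_)))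
  ext a
  exact PSSet.glue.condition k a

variable {f g}

/-- The map `Y ∪_A Z ⟶ T` determined by maps on `Y` and `Z` that agree on `A`. -/
def glue.desc {T : SymSpec.{u}} (p : Y ⟶ T) (q : Z ⟶ T) (h : f ≫ p = g ≫ q) :
    glue f g ⟶ T where
  lvl n := PSSet.glue.desc (Hom.lvl p n) (Hom.lvl q n)
    (fun k a => congrArg (fun r => ap r n k a) h)
  lvl_act := by
    rintro n π k ⟨y | z⟩
    · exact Hom.lvl_act p n π k y
    · exact Hom.lvl_act q n π k z
  lvl_susp := by
    rintro k n ⟨y | z⟩ t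
    · exact Hom.lvl_susp p k n y t
    · exact Hom.lvl_susp q k n z t

end

/-- The trivial symmetric spectrum `*`. -/
def point : SymSpec.{u} where
  lvl _ := ⟨𝟙_ _, fun _ => PUnit.unit, fun _ => rfl⟩
  act _ _ := 𝟙 _
  act_one _ _ _ := rfl
  act_mul _ _ _ _ _ := rfl
  susp _ _ _ _ := PUnit.unit
  susp_pt_left _ _ _ := rfl
  susp_pt_right _ _ _ := rfl
  susp_nat _ _ _ _ := rfl
  susp_equivariant _ _ _ _ _ _ _ := rfl

/-- The unique map `* ⟶ X`. -/
def fromPoint (X : SymSpec.{u}) : point ⟶ X where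
  lvl n := homMk (fun k _ => (X.lvl n).pt k) (fun _ _ => by simp) (fun _ => rfl)
  lvl_act n π k _ := (PSSet.Hom.app_pt (X.act n π) k).symm
  lvl_susp k n _ t := (X.susp_pt_left k n t).symm

/-- The wedge `X ∨ Y`. -/
abbrev wedge (X Y : SymSpec.{u}) : SymSpec.{u} := glue (fromPoint X) (fromPoint Y)

/-- The map `f ∨ g : X ∨ Y ⟶ T` which is `f` on `X` and `g` on `Y`. -/
def wedgeDesc {X Y T : SymSpec.{u}} (f : X ⟶ T) (g : Y ⟶ T) : wedge X Y ⟶ T :=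
  glue.desc f g (by
    refine Hom.ext (funext fun n => PSSet.Hom.ext (NatTrans.ext (funext fun k => ?_)))
    ext a
    exact (PSSet.Hom.app_pt (Hom.lvl f n) k).trans (PSSet.Hom.app_pt (Hom.lvl g n) k).symm)

/-- The suspension `ΣX = X ∧ S¹`. -/
abbrev suspension (X : SymSpec.{u}) : SymSpec.{u} := X.smash circle

/-- The inclusion of `X` in the base of its cone `X ∧ Δ[1]`, where `Δ[1]` is based at `1`. -/
def coneIncl (X : SymSpec.{u}) : X ⟶ X.smash interval :=
  X.inclAt interval (fun k => SSet.stdSimplex.const 1 0 k) (map_const 0)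

/-- The homotopy cofiber (mapping cone) `Y ∪_X (X ∧ Δ[1])` of `f : X ⟶ Y`. -/
abbrev cofiber {X Y : SymSpec.{u}} (f : X ⟶ Y) : SymSpec.{u} := glue f (coneIncl X)

/-- The map of homotopy cofibers induced by a commutative square. -/
def cofiberMap {X Y X' Y' : SymSpec.{u}} (f : X ⟶ Y) (f' : X' ⟶ Y') (a : X ⟶ X') (b : Y ⟶ Y')
    (h : f ≫ b = a ≫ f') : cofiber f ⟶ cofiber f' :=
  glue.desc (b ≫ glue.inl f' (coneIncl X')) (smashMap a interval ≫ glue.inr f' (coneIncl X')) (by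
    rw [← Category.assoc, h, Category.assoc, glue.condition]
    rfl)

/-- The `2`-cofiber (total cofiber) of a commutative square of symmetric spectra with
`α : M₀₀ ⟶ M₀₁`, `β : M₀₀ ⟶ M₁₀`, `γ : M₁₀ ⟶ M₁₁` and `δ : M₀₁ ⟶ M₁₁`: the homotopy cofiber of the map
from the homotopy cofiber of `β` to the homotopy cofiber of `δ` that is induced by `α` and `γ`. -/
def cofiber₂ {M₀₀ M₀₁ M₁₀ M₁₁ : SymSpec.{u}} (α : M₀₀ ⟶ M₀₁) (β : M₀₀ ⟶ M₁₀) (γ : M₁₀ ⟶ M₁₁)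
    (δ : M₀₁ ⟶ M₁₁) (h : β ≫ γ = α ≫ δ) : SymSpec.{u} :=
  cofiber (cofiberMap β δ α γ h)

/-! ### Stable equivalences -/

/-- A map is a level equivalence if each `Xₙ ⟶ Yₙ` is a weak equivalence of simplicial sets. -/
def IsLevelEquiv {X Y : SymSpec.{u}} (f : X ⟶ Y) : Prop :=
  ∀ n, SSet.IsWeakEquiv (PSSet.Hom.hom (Hom.lvl f n))

/-- `E` is injective if it has the extension property with respect to every monomorphism (levelwise
injection) of symmetric spectra that is a level equivalence. -/
def IsInjective (E : SymSpec.{u}) : Prop :=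
  ∀ (A B : SymSpec.{u}) (i : A ⟶ B), (∀ n k, Function.Injective (ap i n k)) → IsLevelEquiv i →
    ∀ f : A ⟶ E, ∃ g : B ⟶ E, i ≫ g = f

/-- The adjoint `Eₙ ⟶ Map_*(S¹, Eₙ₊₁)` of the structure map. -/
def adjSusp (E : SymSpec.{u}) (n : ℕ) : (E.lvl n).toSSet ⟶ (loops (E.lvl (n + 1))).toSSet where
  app k := ↾fun x => ⟨{ app := fun l θ => ↾fun t => E.susp l n ((E.lvl n).toSSet.map θ x) t
                        naturality := fun {l m} η θ => by
                          ext t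
                          have := E.susp_nat η n ((E.lvl n).toSSet.map θ x) t
                          rw [← Functor.map_comp_apply] at this
                          exact this },
    fun l _ => E.susp_pt_right l n _⟩
  naturality k l θ := by
    ext x
    refine Subtype.ext (Functor.HomObj.ext (funext fun m => funext fun η => ?_))
    ext t
    exact congrArg (fun y => E.susp m n y t)
      (Functor.map_comp_apply (E.lvl n).toSSet θ η x).symm

/-- `E` is an `Ω`-spectrum if each `Eₙ` is a Kan complex and each `Eₙ ⟶ Map_*(S¹, Eₙ₊₁)` is a weak
equivalence. -/
def IsOmega (E : SymSpec.{u}) : Prop :=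
  ∀ n, SSet.KanComplex (E.lvl n).toSSet ∧ SSet.IsWeakEquiv (E.adjSusp n)

/-- The inclusion of `X` in `X ∧ Δ[1]₊` at the vertex `i`. -/
def cylIncl (X : SymSpec.{u}) (i : Fin 2) : X ⟶ X.smash (plus SSet.Δ1) :=
  X.inclAt (plus SSet.Δ1) (fun k => some (SSet.stdSimplex.const 1 i k)) (fun _ => rfl)

/-- `f` and `g` are related by a homotopy `X ∧ Δ[1]₊ ⟶ E`. -/
def HomotopyRel {X E : SymSpec.{u}} (f g : X ⟶ E) : Prop :=
  ∃ H : X.smash (plus SSet.Δ1) ⟶ E, X.cylIncl 0 ≫ H = f ∧ X.cylIncl 1 ≫ H = g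

/-- `E⁰(X) = π₀ Map(X, E)`: maps modulo the equivalence relation generated by homotopies. -/
def E0 (E X : SymSpec.{u}) : Type u := Quot (HomotopyRel (X := X) (E := E))

/-- The map `E⁰(Y) → E⁰(X)` induced by `f : X ⟶ Y`. -/
def E0.map (E : SymSpec.{u}) {X Y : SymSpec.{u}} (f : X ⟶ Y) : E0 E Y → E0 E X :=
  Quot.lift (fun g => Quot.mk _ (f ≫ g)) (by
    rintro g g' ⟨H, rfl, rfl⟩
    exact Quot.sound ⟨smashMap f (plus SSet.Δ1) ≫ H, rfl, rfl⟩)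

/-- A map `f : X ⟶ Y` of symmetric spectra is an equivalence (stable equivalence) if
`E⁰(Y) → E⁰(X)` is a bijection for every injective `Ω`-spectrum `E`. -/
def IsStableEquiv {X Y : SymSpec.{u}} (f : X ⟶ Y) : Prop :=
  ∀ E : SymSpec.{u}, IsInjective E → IsOmega E → Function.Bijective (E0.map E f)

/-- `X ≃ Y`: the symmetric spectra `X` and `Y` are connected by a zigzag of stable equivalences. -/
def Equivalent (X Y : SymSpec.{u}) : Prop :=
  Relation.EqvGen (fun X Y : SymSpec.{u} => ∃ f : X ⟶ Y, IsStableEquiv f) X Y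

end SymSpec

end

/-!
For an injective `Ω`-spectrum `E`, the mapping spaces `Map(X, E)` are Kan complexes, and since the
cotensors `E ^ L` are again injective `Ω`-spectra, a map `f` is a stable equivalence if and only if
every `Map(f, E)` is a weak equivalence. As `Map(-, E)` turns pushouts along injections into
pullbacks along Kan fibrations, stable equivalences are preserved by cobase change along injections.

Since `β ∨ s` is an equivalence, the cofiber of `β` is equivalent to that of `M₀₀ ⟶ M₀₀ ∨ M₁₁`,
and hence to `M₁₁`, by way of `s`. As `γ s = 𝟙`, the composite of this equivalence with the map of
cofibers `C(β) ⟶ C(δ)` is the inclusion of `M₁₁` in `C(δ) = M₁₁ ∪ Cone(M₀₁)`. So the total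
cofiber is equivalent to the cofiber of that inclusion, which is `Σ M₀₁`.
-/

universe v w

noncomputable section

namespace SimplicialHomotopy

open SSet Simplicial HomotopicalAlgebra Limits CartesianMonoidalCategory modelCategoryQuillen

variable {A B K L S T X Y Z : SSet.{u}}

/-- A map of simplicial sets from its values on simplices. -/
def ofFun (f : ∀ k, X.obj k → Y.obj k)
    (hf : ∀ {k l : SimplexCategoryᵒᵖ} (θ : k ⟶ l) (x : X.obj k),
      f l (X.map θ x) = Y.map θ (f k x)) : X ⟶ Y where
  app k := ↾(f k)
  naturality k l θ := by
    ext x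
    exact hf θ x

theorem hom_ext_apply {f g : X ⟶ Y} (h : ∀ k x, f.app k x = g.app k x) : f = g := by
  refine NatTrans.ext (funext fun k => ?_)
  ext x
  exact h k x

theorem congr_apply {f g : X ⟶ Y} (h : f = g) (k : SimplexCategoryᵒᵖ) (x : X.obj k) :
    f.app k x = g.app k x := by
  rw [h]

theorem mono_iff_injective {f : X ⟶ Y} : Mono f ↔ ∀ k, Function.Injective (f.app k) := by
  rw [NatTrans.mono_iff_mono_app]
  exact forall_congr' fun k => CategoryTheory.mono_iff_injective (f.app k)

theorem mono_whiskerLeft (i : A ⟶ B) [hi : Mono i] (K : SSet.{u}) : Mono (K ◁ i) :=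
  mono_iff_injective.2 fun k => by
    rintro ⟨x, s⟩ ⟨y, t⟩ h
    obtain ⟨h₁, h₂⟩ := Prod.mk.inj (show (x, i.app k s) = (y, i.app k t) from h)
    exact Prod.ext h₁ (mono_iff_injective.1 hi k h₂)

/-! ### Lifting properties -/

theorem fibration_of_exists_lift {p : X ⟶ Y}
    (h : ∀ (n : ℕ) (i : Fin (n + 2)) (σ : (Λ[n + 1, i] : SSet.{u}) ⟶ X) (τ : Δ[n + 1] ⟶ Y),
      σ ≫ p = Λ[n + 1, i].ι ≫ τ → ∃ χ : Δ[n + 1] ⟶ X, Λ[n + 1, i].ι ≫ χ = σ ∧ χ ≫ p = τ) :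
    Fibration p := by
  refine (modelCategoryQuillen.fibration_iff p).2 fun _ _ _ hf => ?_
  simp only [J, MorphismProperty.iSup_iff] at hf
  obtain ⟨n, ⟨i⟩⟩ := hf
  refine ⟨fun {s t} sq => ?_⟩
  obtain ⟨χ, h₁, h₂⟩ := h n i s t sq.w
  exact ⟨⟨{ l := χ, fac_left := h₁, fac_right := h₂ }⟩⟩

theorem kanComplex_of_exists_extension
    (h : ∀ (n : ℕ) (i : Fin (n + 2)) (σ : (Λ[n + 1, i] : SSet.{u}) ⟶ Z),
      ∃ τ : Δ[n + 1] ⟶ Z, Λ[n + 1, i].ι ≫ τ = σ) : KanComplex Z := by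
  refine (isFibrant_iff Z).2 (fibration_of_exists_lift fun n i σ _ _ => ?_)
  obtain ⟨χ, hχ⟩ := h n i σ
  exact ⟨χ, hχ, by subsingleton⟩

theorem exists_extension_of_anodyneExtensions [KanComplex Z] {j : K ⟶ L}
    (hj : anodyneExtensions j) (a : K ⟶ Z) : ∃ b : L ⟶ Z, j ≫ b = a := by
  have := hj (terminal.from Z) (mem_fibrations _)
  have sq : CommSq a j (terminal.from Z) (terminal.from L) := ⟨by subsingleton⟩
  exact ⟨sq.lift, sq.fac_left⟩

theorem exists_lift_pushoutProduct (i : A ⟶ B) [Mono i] {j : K ⟶ L}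
    (hj : anodyneExtensions j) (p : S ⟶ T) [Fibration p] (a : A ⊗ L ⟶ S) (b : B ⊗ K ⟶ S)
    (w : B ⊗ L ⟶ T) (hab : A ◁ j ≫ a = i ▷ K ≫ b) (ha : a ≫ p = i ▷ L ≫ w)
    (hb : b ≫ p = B ◁ j ≫ w) :
    ∃ χ : B ⊗ L ⟶ S, i ▷ L ≫ χ = a ∧ B ◁ j ≫ χ = b ∧ χ ≫ p = w := by
  let sq := Functor.PushoutObjObj.ofHasPushout (curriedTensor SSet.{u}) i j
  have := anodyneExtensions_pushoutObjObjι sq hj p (mem_fibrations p)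
  have inl_ι : sq.inl ≫ sq.ι = B ◁ j := sq.inl_ι
  have inr_ι : sq.inr ≫ sq.ι = i ▷ L := sq.inr_ι
  have hc : CommSq (sq.isPushout.desc b a hab.symm) sq.ι p w := by
    refine ⟨sq.isPushout.hom_ext ?_ ?_⟩
    · rw [sq.isPushout.inl_desc_assoc, reassoc_of% inl_ι, hb]
    · rw [sq.isPushout.inr_desc_assoc, reassoc_of% inr_ι, ha]
  refine ⟨hc.lift, ?_, ?_, hc.fac_right⟩
  · rw [← inr_ι, Category.assoc, hc.fac_left, sq.isPushout.inr_desc]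
  · rw [← inl_ι, Category.assoc, hc.fac_left, sq.isPushout.inl_desc]

theorem exists_extension_pushoutProduct [KanComplex Z] (i : A ⟶ B) [Mono i] {j : K ⟶ L}
    (hj : anodyneExtensions j) (a : A ⊗ L ⟶ Z) (b : B ⊗ K ⟶ Z) (hab : A ◁ j ≫ a = i ▷ K ≫ b) :
    ∃ χ : B ⊗ L ⟶ Z, i ▷ L ≫ χ = a ∧ B ◁ j ≫ χ = b := by
  obtain ⟨χ, h₁, h₂, -⟩ := exists_lift_pushoutProduct i hj (terminal.from Z) a b
    (terminal.from _) hab (by subsingleton) (by subsingleton)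
  exact ⟨χ, h₁, h₂⟩

open MorphismProperty in
theorem anodyneExtensions_le_monomorphisms :
    anodyneExtensions.{u} ≤ monomorphisms SSet.{u} := by
  rw [anodyneExtensions_eq_retracts_transfiniteCompositions, retracts_le_iff,
    transfiniteCompositions_le_iff, pushouts_le_iff, coproducts_le_iff]
  exact J_le_monomorphisms

/-! ### Homotopies -/

theorem mem_horn_one_iff {k : SimplexCategoryᵒᵖ} {ε : Fin 2} {s : (Δ[1] : SSet.{u}).obj k} :
    s ∈ (horn.{u} 1 ε).obj k ↔ s = stdSimplex.const 1 ε k := by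
  rw [mem_horn_iff, Ne, Set.eq_univ_iff_forall, not_forall]
  constructor
  · rintro ⟨j, hj⟩
    rw [Set.mem_union, not_or] at hj
    refine stdSimplex.objEquiv.injective (SimplexCategory.Hom.ext _ _ (OrderHom.ext _ _ (funext
      fun m => ?_)))
    have h₁ : stdSimplex.asOrderHom s m ≠ j := fun h => hj.1 ⟨m, h⟩
    have h₂ : ε ≠ j := fun h => hj.2 h.symm
    change stdSimplex.asOrderHom s m = ε
    omega
  · rintro rfl
    refine ⟨1 - ε, ?_⟩
    rintro (⟨m, hm⟩ | h)
    · change ε = 1 - ε at hm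
      omega
    · change 1 - ε = ε at h
      omega

theorem mem_boundary_one_iff {k : SimplexCategoryᵒᵖ} {s : (Δ[1] : SSet.{u}).obj k} :
    s ∈ (boundary.{u} 1).obj k ↔ ∃ ε, s = stdSimplex.const 1 ε k := by
  change ¬ Function.Surjective (stdSimplex.asOrderHom s) ↔ _
  constructor
  · intro hs
    obtain ⟨j, hj⟩ := not_forall.1 hs
    refine ⟨1 - j, mem_horn_one_iff.1 ?_⟩
    rw [mem_horn_iff, Ne, Set.eq_univ_iff_forall, not_forall]
    refine ⟨j, ?_⟩
    rintro (h | h)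
    · exact hj h
    · exact (by decide : ∀ i : Fin 2, i ≠ 1 - i) j h
  · rintro ⟨ε, rfl⟩ h
    obtain ⟨_, hm⟩ := h (1 - ε)
    exact (by decide : ∀ i : Fin 2, i ≠ 1 - i) ε hm

theorem const_injective (k : SimplexCategoryᵒᵖ) :
    Function.Injective fun ε => stdSimplex.const.{u} 1 ε k := fun _ _ h =>
  congrArg (fun s => stdSimplex.asOrderHom s 0) h

/-- The inclusion `X ⟶ X × Δ[1]` at the vertex `ε`. -/
def incl (ε : Fin 2) (X : SSet.{u}) : X ⟶ X ⊗ Δ[1] :=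
  ofFun (fun k x => (x, stdSimplex.const 1 ε k)) (fun _ _ => rfl)

theorem exists_homotopy_lift (ε : Fin 2) (i : K ⟶ L) [Mono i] (p : X ⟶ Y) [Fibration p]
    (f : L ⟶ X) (H : K ⊗ Δ[1] ⟶ X) (h : L ⊗ Δ[1] ⟶ Y) (hf : incl ε K ≫ H = i ≫ f)
    (hp : H ≫ p = i ▷ _ ≫ h) (hfp : incl ε L ≫ h = f ≫ p) :
    ∃ H' : L ⊗ Δ[1] ⟶ X, i ▷ _ ≫ H' = H ∧ incl ε L ≫ H' = f ∧ H' ≫ p = h := by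
  have h₁ : K ◁ (horn.{u} 1 ε).ι ≫ H = i ▷ _ ≫ fst L _ ≫ f := by
    refine hom_ext_apply fun k => ?_
    rintro ⟨x, ⟨s, hs⟩⟩
    obtain rfl := mem_horn_one_iff.1 hs
    exact congr_apply hf k x
  have h₂ : (fst L _ ≫ f) ≫ p = L ◁ (horn.{u} 1 ε).ι ≫ h := by
    refine hom_ext_apply fun k => ?_
    rintro ⟨x, ⟨s, hs⟩⟩
    obtain rfl := mem_horn_one_iff.1 hs
    exact (congr_apply hfp k x).symm
  obtain ⟨χ, h₃, h₄, h₅⟩ := exists_lift_pushoutProduct i (anodyneExtensions.horn_ι ε) p H _ h h₁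
    hp h₂
  refine ⟨χ, h₃, hom_ext_apply fun k x => ?_, h₅⟩
  exact congr_apply h₄ k (x, ⟨_, mem_horn_one_iff.2 rfl⟩)

/-- The inclusion `X ⟶ X × ∂Δ[1]` at the vertex `ε`. -/
def inclBoundary (ε : Fin 2) (X : SSet.{u}) : X ⟶ X ⊗ (boundary.{u} 1 : SSet.{u}) :=
  ofFun (fun k x => (x, ⟨stdSimplex.const 1 ε k, mem_boundary_one_iff.2 ⟨ε, rfl⟩⟩))
    (fun _ _ => rfl)

theorem hom_ext_boundary {f g : L ⊗ (boundary.{u} 1 : SSet.{u}) ⟶ X}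
    (h : ∀ ε, inclBoundary ε L ≫ f = inclBoundary ε L ≫ g) : f = g := by
  refine hom_ext_apply fun k => ?_
  rintro ⟨x, ⟨s, hs⟩⟩
  obtain ⟨ε, rfl⟩ := mem_boundary_one_iff.1 hs
  exact congr_apply (h ε) k x

/-- The map on `L × ∂Δ[1]` given by two maps on `L`. -/
def boundaryDesc (f : Fin 2 → (L ⟶ X)) : L ⊗ (boundary.{u} 1 : SSet.{u}) ⟶ X :=
  ofFun (fun k x => (f (stdSimplex.asOrderHom x.2.1 0)).app k x.1) (by
    rintro k l θ ⟨x, ⟨s, hs⟩⟩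
    obtain ⟨ε, rfl⟩ := mem_boundary_one_iff.1 hs
    exact NatTrans.naturality_apply (f ε) θ x)

theorem whiskerLeft_boundary_comp_eq_iff (f : Fin 2 → (L ⟶ X)) (H : L ⊗ Δ[1] ⟶ X) :
    L ◁ (boundary.{u} 1).ι ≫ H = boundaryDesc f ↔ ∀ ε, incl ε L ≫ H = f ε :=
  ⟨fun h ε => congrArg (inclBoundary ε L ≫ ·) h, fun h => hom_ext_boundary h⟩

/-- Two maps are joined by a single homotopy; for maps to a Kan complex this is an equivalence
relation. -/
def Homotopic (f g : X ⟶ Y) : Prop :=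
  ∃ H : X ⊗ Δ[1] ⟶ Y, incl 0 X ≫ H = f ∧ incl 1 X ≫ H = g

theorem nonempty_homotopy_iff {f g : X ⟶ Y} : Nonempty (Homotopy f g) ↔ Homotopic f g := by
  constructor
  · rintro ⟨H⟩
    exact ⟨H.h, H.h₀, H.h₁⟩
  · rintro ⟨H, h₀, h₁⟩
    exact ⟨{ h := H
             h₀ := h₀
             h₁ := h₁
             rel := by
               ext _ ⟨⟨_, hx⟩, _⟩
               exact hx.elim }⟩

theorem Homotopic.refl (f : X ⟶ Y) : Homotopic f f :=
  ⟨fst _ _ ≫ f, rfl, rfl⟩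

theorem Homotopic.comp_right {f g : X ⟶ Y} (h : Homotopic f g) (p : Y ⟶ Z) :
    Homotopic (f ≫ p) (g ≫ p) := by
  obtain ⟨H, rfl, rfl⟩ := h
  exact ⟨H ≫ p, rfl, rfl⟩

theorem Homotopic.comp_left {f g : X ⟶ Y} (h : Homotopic f g) (e : Z ⟶ X) :
    Homotopic (e ≫ f) (e ≫ g) := by
  obtain ⟨H, rfl, rfl⟩ := h
  exact ⟨e ▷ _ ≫ H, rfl, rfl⟩

theorem exists_square (ε : Fin 2) (p : X ⟶ Y) [Fibration p] (H : Fin 2 → (L ⊗ Δ[1] ⟶ X))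
    (f : L ⊗ Δ[1] ⟶ X) (h : (L ⊗ Δ[1]) ⊗ Δ[1] ⟶ Y) (hf : ∀ η, incl ε L ≫ H η = incl η L ≫ f)
    (hp : ∀ η, H η ≫ p = incl η L ▷ _ ≫ h) (hfp : incl ε _ ≫ h = f ≫ p) :
    ∃ S : (L ⊗ Δ[1]) ⊗ Δ[1] ⟶ X, (∀ η, incl η L ▷ _ ≫ S = H η) ∧ incl ε _ ≫ S = f ∧
      S ≫ p = h := by
  let swap : (L ⊗ (boundary.{u} 1 : SSet.{u})) ⊗ Δ[1] ⟶ (L ⊗ Δ[1]) ⊗ boundary.{u} 1 :=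
    ofFun (fun _ x => ((x.1.1, x.2), x.1.2)) (fun _ _ => rfl)
  have := mono_whiskerLeft (boundary.{u} 1).ι L
  have hG : incl ε _ ≫ swap ≫ boundaryDesc H = L ◁ (boundary.{u} 1).ι ≫ f :=
    hom_ext_boundary hf
  have hGp : (swap ≫ boundaryDesc H) ≫ p = (L ◁ (boundary.{u} 1).ι) ▷ _ ≫ h := by
    refine hom_ext_apply ?_
    rintro k ⟨⟨x, ⟨s, hs⟩⟩, t⟩
    obtain ⟨η, rfl⟩ := mem_boundary_one_iff.1 hs
    exact congr_apply (hp η) k (x, t)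
  obtain ⟨S, h₁, h₂, h₃⟩ := exists_homotopy_lift ε (L ◁ (boundary.{u} 1).ι) p f _ h hG hGp hfp
  exact ⟨S, fun η => congrArg (inclBoundary η L ▷ _ ≫ ·) h₁, h₂, h₃⟩

theorem Homotopic.euclidean [KanComplex Z] {f g h : X ⟶ Z} (h₁ : Homotopic f g)
    (h₂ : Homotopic f h) : Homotopic g h := by
  obtain ⟨H, rfl, rfl⟩ := h₁
  obtain ⟨H', h', rfl⟩ := h₂
  obtain ⟨S, hS, -⟩ := exists_square 0 (terminal.from Z) ![H, H'] (fst _ _ ≫ incl 0 X ≫ H)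
    (terminal.from _) (Fin.forall_fin_two.2 ⟨rfl, h'⟩) (fun _ => by subsingleton)
    (by subsingleton)
  exact ⟨incl 1 _ ≫ S, (congrArg (incl 1 X ≫ ·) (hS 0) :), (congrArg (incl 1 X ≫ ·) (hS 1) :)⟩

theorem Homotopic.symm [KanComplex Z] {f g : X ⟶ Z} (h : Homotopic f g) : Homotopic g f :=
  h.euclidean (.refl f)

theorem Homotopic.trans [KanComplex Z] {f g h : X ⟶ Z} (h₁ : Homotopic f g)
    (h₂ : Homotopic g h) : Homotopic f h :=
  h₁.symm.euclidean h₂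

theorem Homotopic.of_eqvGen [KanComplex Z] {f g : X ⟶ Z}
    (h : Relation.EqvGen Homotopic f g) : Homotopic f g := by
  induction h with
  | rel _ _ h => exact h
  | refl _ => exact .refl _
  | symm _ _ _ ih => exact ih.symm
  | trans _ _ _ _ _ ih₁ ih₂ => exact ih₁.trans ih₂

/-! ### Homotopy equivalences -/

/-- A map with a two-sided inverse up to a single homotopy. -/
def IsHomotopyEquiv (f : X ⟶ Y) : Prop :=
  ∃ g : Y ⟶ X, Homotopic (f ≫ g) (𝟙 X) ∧ Homotopic (g ≫ f) (𝟙 Y)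

theorem IsHomotopyEquiv.comp_iso {f : X ⟶ Y} (hf : IsHomotopyEquiv f) (e : Y ≅ Z) :
    IsHomotopyEquiv (f ≫ e.hom) := by
  obtain ⟨g, h₁, h₂⟩ := hf
  refine ⟨e.inv ≫ g, by simpa using h₁, ?_⟩
  simpa using (h₂.comp_left e.inv).comp_right e.hom

theorem exists_section_of_homotopic {p : X ⟶ Y} [Fibration p] {g : Y ⟶ X}
    (hg : Homotopic (g ≫ p) (𝟙 Y)) : ∃ q : Y ⟶ X, q ≫ p = 𝟙 Y := by
  obtain ⟨H, h₀, h₁⟩ := hg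
  obtain ⟨H', -, -, h⟩ := exists_homotopy_lift 0 (⊥ : Y.Subcomplex).ι p g
    (ofFun (fun _ x => x.1.2.elim) (fun _ x => x.1.2.elim)) H (hom_ext_apply fun _ x => x.2.elim)
    (hom_ext_apply fun _ x => x.1.2.elim) h₀
  exact ⟨incl 1 Y ≫ H', by rw [Category.assoc, h, h₁]⟩

theorem exists_fibrewise_homotopy {p : X ⟶ Y} [Fibration p] {q : Y ⟶ X} (hq : q ≫ p = 𝟙 Y)
    (h : Homotopic (𝟙 X) (p ≫ q)) :
    ∃ F : X ⊗ Δ[1] ⟶ X, incl 0 X ≫ F = 𝟙 X ∧ incl 1 X ≫ F = p ≫ q ∧ F ≫ p = fst _ _ ≫ p := by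
  obtain ⟨G, hG₀, hG₁⟩ := h
  -- The concatenation of `G` with the reverse of `G ≫ p ≫ q` projects to a null-homotopic loop.
  obtain ⟨S, hS₁, -, hS₃⟩ := exists_square 1 p ![G, G ≫ p ≫ q] (fst _ _ ≫ p ≫ q)
    (fst _ _ ▷ _ ≫ G ≫ p)
    (Fin.forall_fin_two.2 ⟨hG₁, by
      change (incl 1 X ≫ G) ≫ p ≫ q = p ≫ q
      rw [hG₁, Category.assoc, reassoc_of% hq]⟩)
    (Fin.forall_fin_two.2 ⟨rfl, by
      change (G ≫ p ≫ q) ≫ p = G ≫ p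
      simp only [Category.assoc, hq, Category.comp_id]⟩)
    (by
      change fst _ _ ≫ (incl 1 X ≫ G) ≫ p = _
      rw [hG₁, Category.assoc, Category.assoc, Category.assoc])
  refine ⟨incl 0 _ ≫ S, (congrArg (incl 0 X ≫ ·) (hS₁ 0)).trans hG₀,
    (congrArg (incl 0 X ≫ ·) (hS₁ 1)).trans ?_, ?_⟩
  · change (incl 0 X ≫ G) ≫ p ≫ q = p ≫ q
    rw [hG₀, Category.id_comp]
  · rw [Category.assoc, hS₃]
    change fst _ _ ≫ (incl 0 X ≫ G) ≫ p = _
    rw [hG₀, Category.id_comp]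

theorem IsHomotopyEquiv.rlp_monomorphisms [KanComplex X] {p : X ⟶ Y} [Fibration p]
    (hp : IsHomotopyEquiv p) : (MorphismProperty.monomorphisms SSet.{u}).rlp p := by
  obtain ⟨g, h₁, h₂⟩ := hp
  obtain ⟨q, hq⟩ := exists_section_of_homotopic h₂
  have hpq : Homotopic (𝟙 X) (p ≫ q) := by
    have h₃ := h₁.comp_left (p ≫ q)
    rw [Category.assoc, reassoc_of% hq, Category.comp_id] at h₃
    exact h₁.symm.trans h₃
  obtain ⟨F, hF₀, hF₁, hF⟩ := exists_fibrewise_homotopy hq hpq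
  intro K L i hi
  have : Mono i := hi
  refine ⟨fun {a b} sq => ?_⟩
  obtain ⟨H, h₁, -, h₃⟩ := exists_homotopy_lift 1 i p (b ≫ q) (a ▷ _ ≫ F) (fst _ _ ≫ b)
    (by
      change a ≫ incl 1 X ≫ F = _
      rw [hF₁, reassoc_of% sq.w])
    (by
      rw [Category.assoc, hF]
      exact congrArg (fst _ _ ≫ ·) sq.w)
    (by
      rw [Category.assoc, hq, Category.comp_id]
      rfl)
  refine ⟨⟨incl 0 L ≫ H, ?_, by rw [Category.assoc, h₃]; rfl⟩⟩
  calc i ≫ incl 0 L ≫ H = a ≫ incl 0 X ≫ F := congrArg (incl 0 K ≫ ·) h₁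
    _ = a := by rw [hF₀, Category.comp_id]

theorem isHomotopyEquiv_of_rlp_monomorphisms {p : X ⟶ Y}
    (hp : (MorphismProperty.monomorphisms SSet.{u}).rlp p) : IsHomotopyEquiv p := by
  have lift {K L : SSet.{u}} (i : K ⟶ L) [Mono i] (a : K ⟶ X) (b : L ⟶ Y) (h : a ≫ p = i ≫ b) :
      ∃ c : L ⟶ X, i ≫ c = a ∧ c ≫ p = b := by
    have := hp i ‹_›
    have sq : CommSq a i p b := ⟨h⟩
    exact ⟨sq.lift, sq.fac_left, sq.fac_right⟩
  obtain ⟨q, -, hq⟩ := lift (⊥ : Y.Subcomplex).ι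
    (ofFun (fun _ x => x.2.elim) (fun _ x => x.2.elim)) (𝟙 Y) (hom_ext_apply fun _ x => x.2.elim)
  have := mono_whiskerLeft (boundary.{u} 1).ι X
  obtain ⟨H, hH, -⟩ := lift (X ◁ (boundary.{u} 1).ι) (boundaryDesc ![p ≫ q, 𝟙 X]) (fst _ _ ≫ p)
    (hom_ext_boundary (Fin.forall_fin_two.2
      ⟨(show (p ≫ q) ≫ p = p by rw [Category.assoc, hq, Category.comp_id]), rfl⟩))
  rw [whiskerLeft_boundary_comp_eq_iff] at hH
  exact ⟨q, ⟨H, hH 0, hH 1⟩, by rw [hq]; exact .refl _⟩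

/-! ### Weak equivalences -/

theorem hoClass_mk_eq_iff [KanComplex Z] {f g : X ⟶ Z} :
    (Quot.mk _ f : HoClass X Z) = Quot.mk _ g ↔ Homotopic f g :=
  ⟨fun h => .of_eqvGen ((Quot.eqvGen_exact h).mono fun _ _ => nonempty_homotopy_iff.1),
    fun h => Quot.sound (nonempty_homotopy_iff.2 h)⟩

theorem isWeakEquiv_iff (f : X ⟶ Y) :
    IsWeakEquiv f ↔ ∀ Z : SSet.{u}, KanComplex Z →
      (∀ b b' : Y ⟶ Z, Homotopic (f ≫ b) (f ≫ b') → Homotopic b b') ∧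
        ∀ a : X ⟶ Z, ∃ b : Y ⟶ Z, Homotopic (f ≫ b) a := by
  refine forall_congr' fun Z => forall_congr' fun hZ => and_congr ⟨?_, ?_⟩ ⟨?_, ?_⟩
  · intro h b b' hb
    exact hoClass_mk_eq_iff.1 (h (hoClass_mk_eq_iff.2 hb))
  · rintro h ⟨b⟩ ⟨b'⟩ hb
    exact hoClass_mk_eq_iff.2 (h b b' (hoClass_mk_eq_iff.1 hb))
  · intro h a
    obtain ⟨⟨b⟩, hb⟩ := h (Quot.mk _ a)
    exact ⟨b, hoClass_mk_eq_iff.1 hb⟩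
  · rintro h ⟨a⟩
    obtain ⟨b, hb⟩ := h a
    exact ⟨Quot.mk _ b, hoClass_mk_eq_iff.2 hb⟩

theorem hoClass_precomp_comp (f : X ⟶ Y) (g : Y ⟶ Z) (T : SSet.{u}) :
    HoClass.precomp (f ≫ g) T = HoClass.precomp f T ∘ HoClass.precomp g T := by
  funext a
  obtain ⟨a, rfl⟩ := Quot.exists_rep a
  exact congrArg (Quot.mk _) (Category.assoc f g a)

theorem isWeakEquiv_comp {f : X ⟶ Y} {g : Y ⟶ Z} (hf : IsWeakEquiv f) (hg : IsWeakEquiv g) :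
    IsWeakEquiv (f ≫ g) := fun T hT => by
  rw [hoClass_precomp_comp]
  exact (hf T hT).comp (hg T hT)

theorem isWeakEquiv_of_comp_left {f : X ⟶ Y} {g : Y ⟶ Z} (hf : IsWeakEquiv f)
    (h : IsWeakEquiv (f ≫ g)) : IsWeakEquiv g := fun T hT => by
  have h := h T hT
  rw [hoClass_precomp_comp] at h
  exact (Function.Bijective.of_comp_iff' (hf T hT) _).1 h

theorem isWeakEquiv_of_comp_right {f : X ⟶ Y} {g : Y ⟶ Z} (hg : IsWeakEquiv g)
    (h : IsWeakEquiv (f ≫ g)) : IsWeakEquiv f := fun T hT => by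
  have h := h T hT
  rw [hoClass_precomp_comp] at h
  exact (Function.Bijective.of_comp_iff _ (hg T hT)).1 h

theorem IsHomotopyEquiv.isWeakEquiv {f : X ⟶ Y} (hf : IsHomotopyEquiv f) : IsWeakEquiv f := by
  obtain ⟨g, h₁, h₂⟩ := hf
  refine (isWeakEquiv_iff f).2 fun Z hZ => ⟨fun b b' h => ?_, fun a => ⟨g ≫ a, ?_⟩⟩
  · have h₃ := h.comp_left g
    have h₄ := h₂.comp_right b
    have h₅ := h₂.comp_right b'
    rw [Category.assoc, Category.id_comp] at h₄ h₅
    exact h₄.symm.trans (h₃.trans h₅)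
  · simpa only [Category.assoc, Category.id_comp] using h₁.comp_right a

theorem isHomotopyEquiv_of_isWeakEquiv [KanComplex X] [KanComplex Y] {f : X ⟶ Y}
    (hf : IsWeakEquiv f) : IsHomotopyEquiv f := by
  obtain ⟨g, hg⟩ := ((isWeakEquiv_iff f).1 hf X inferInstance).2 (𝟙 X)
  refine ⟨g, hg, ((isWeakEquiv_iff f).1 hf Y inferInstance).1 _ _ ?_⟩
  simpa only [Category.assoc, Category.id_comp, Category.comp_id] using hg.comp_right f

theorem isWeakEquiv_of_exists_extension {f : X ⟶ Y}
    (h₁ : ∀ (Z : SSet.{u}) [KanComplex Z] (a : X ⟶ Z), ∃ b : Y ⟶ Z, f ≫ b = a)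
    (h₂ : ∀ (Z : SSet.{u}) [KanComplex Z] (H : X ⊗ Δ[1] ⟶ Z) (b : Fin 2 → (Y ⟶ Z)),
      (∀ ε, incl ε X ≫ H = f ≫ b ε) → ∃ H' : Y ⊗ Δ[1] ⟶ Z, ∀ ε, incl ε Y ≫ H' = b ε) :
    IsWeakEquiv f := by
  refine (isWeakEquiv_iff f).2 fun Z hZ => ⟨?_, fun a => ?_⟩
  · rintro b b' ⟨H, h₀, h₁⟩
    obtain ⟨H', h⟩ := h₂ Z H ![b, b'] (Fin.forall_fin_two.2 ⟨h₀, h₁⟩)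
    exact ⟨H', h 0, h 1⟩
  · obtain ⟨b, rfl⟩ := h₁ Z a
    exact ⟨b, .refl _⟩

theorem isWeakEquiv_of_anodyneExtensions {f : X ⟶ Y} (hf : anodyneExtensions f) :
    IsWeakEquiv f := by
  refine isWeakEquiv_of_exists_extension (fun Z _ => exists_extension_of_anodyneExtensions hf)
    fun Z _ H b hb => ?_
  have h : (boundary.{u} 1 : SSet.{u}) ◁ f ≫ (β_ _ _).hom ≫ boundaryDesc b =
      (boundary.{u} 1).ι ▷ X ≫ (β_ _ _).hom ≫ H := by
    rw [BraidedCategory.braiding_naturality_right_assoc,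
      BraidedCategory.braiding_naturality_left_assoc]
    exact congrArg ((β_ _ _).hom ≫ ·) (hom_ext_boundary fun ε => (hb ε).symm)
  obtain ⟨χ, h₁, -⟩ := exists_extension_pushoutProduct (boundary.{u} 1).ι hf _ _ h
  exact ⟨(β_ _ _).hom ≫ χ,
    fun ε => congrArg (inclBoundary ε Y ≫ (β_ _ (boundary.{u} 1 : SSet.{u})).hom ≫ ·) h₁⟩

/-! ### Function complexes -/

theorem homotopic_curry_iff {f g : A ⊗ L ⟶ Z} :
    Homotopic (MonoidalClosed.curry f) (MonoidalClosed.curry g) ↔ Homotopic f g := by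
  constructor
  · rintro ⟨H, h₀, h₁⟩
    refine ⟨(α_ _ _ _).hom ≫ MonoidalClosed.uncurry H, ?_, ?_⟩
    · rw [← MonoidalClosed.uncurry_curry f, ← h₀, MonoidalClosed.uncurry_natural_left]
      rfl
    · rw [← MonoidalClosed.uncurry_curry g, ← h₁, MonoidalClosed.uncurry_natural_left]
      rfl
  · rintro ⟨H, rfl, rfl⟩
    refine ⟨MonoidalClosed.curry ((α_ _ _ _).inv ≫ H), ?_, ?_⟩
    · rw [← MonoidalClosed.curry_natural_left]
      rfl
    · rw [← MonoidalClosed.curry_natural_left]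
      rfl

theorem homotopic_uncurry_iff {f g : L ⟶ (ihom A).obj Z} :
    Homotopic (MonoidalClosed.uncurry f) (MonoidalClosed.uncurry g) ↔ Homotopic f g := by
  rw [← homotopic_curry_iff, MonoidalClosed.curry_uncurry, MonoidalClosed.curry_uncurry]

theorem homotopic_braiding_iff {f g : A ⊗ L ⟶ Z} :
    Homotopic ((β_ L A).hom ≫ f) ((β_ L A).hom ≫ g) ↔ Homotopic f g := by
  refine ⟨fun h => ?_, fun h => h.comp_left _⟩
  simpa only [Iso.inv_hom_id_assoc] using h.comp_left (β_ L A).inv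

theorem IsHomotopyEquiv.ihom_map {f : X ⟶ Y} (hf : IsHomotopyEquiv f) (L : SSet.{u}) :
    IsHomotopyEquiv ((ihom L).map f) := by
  have homotopic_map {X Y : SSet.{u}} {f g : X ⟶ Y} (h : Homotopic f g) :
      Homotopic ((ihom L).map f) ((ihom L).map g) := by
    rw [← homotopic_uncurry_iff]
    simpa only [MonoidalClosed.uncurry_eq, ihom.ev_naturality] using
      h.comp_left ((ihom.ev L).app X)
  obtain ⟨g, h₁, h₂⟩ := hf
  refine ⟨(ihom L).map g, ?_, ?_⟩
  · rw [← (ihom L).map_comp, ← (ihom L).map_id]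
    exact homotopic_map h₁
  · rw [← (ihom L).map_comp, ← (ihom L).map_id]
    exact homotopic_map h₂

/-- The transpose of a map to a function complex: both sides are maps `L × B ⟶ Z`. -/
def ihomSwap (f : L ⟶ (ihom B).obj Z) : B ⟶ (ihom L).obj Z :=
  MonoidalClosed.curry ((β_ L B).hom ≫ MonoidalClosed.uncurry f)

theorem ihomSwap_ihomSwap (f : L ⟶ (ihom B).obj Z) : ihomSwap (ihomSwap f) = f := by
  rw [ihomSwap, ihomSwap, MonoidalClosed.uncurry_curry, SymmetricCategory.symmetry_assoc,
    MonoidalClosed.curry_uncurry]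

theorem homotopic_ihomSwap_iff {f g : L ⟶ (ihom B).obj Z} :
    Homotopic (ihomSwap f) (ihomSwap g) ↔ Homotopic f g := by
  rw [ihomSwap, ihomSwap, homotopic_curry_iff, homotopic_braiding_iff, homotopic_uncurry_iff]

theorem ihomSwap_comp_pre (i : A ⟶ B) (f : L ⟶ (ihom B).obj Z) :
    ihomSwap (f ≫ (MonoidalClosed.pre i).app Z) = i ≫ ihomSwap f := by
  have h : MonoidalClosed.uncurry (f ≫ (MonoidalClosed.pre i).app Z) =
      i ▷ L ≫ MonoidalClosed.uncurry f := by
    rw [← MonoidalClosed.curry_uncurry f, MonoidalClosed.curry_pre_app,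
      MonoidalClosed.uncurry_curry, MonoidalClosed.uncurry_curry]
  rw [ihomSwap, ihomSwap, h, ← MonoidalClosed.curry_natural_left,
    BraidedCategory.braiding_naturality_right_assoc]

theorem isHomotopyEquiv_pre [KanComplex Z] {i : A ⟶ B} (hi : IsWeakEquiv i) :
    IsHomotopyEquiv ((MonoidalClosed.pre i).app Z) := by
  obtain ⟨g, hg⟩ := ((isWeakEquiv_iff i).1 hi ((ihom _).obj Z) inferInstance).2
    (ihomSwap (𝟙 ((ihom A).obj Z)))
  have hsurj : Homotopic (ihomSwap g ≫ (MonoidalClosed.pre i).app Z) (𝟙 _) := by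
    rwa [← homotopic_ihomSwap_iff, ihomSwap_comp_pre, ihomSwap_ihomSwap]
  refine ⟨ihomSwap g, ?_, hsurj⟩
  rw [← homotopic_ihomSwap_iff]
  refine ((isWeakEquiv_iff i).1 hi _ inferInstance).1 _ _ ?_
  rw [← ihomSwap_comp_pre i (_ ≫ _), ← ihomSwap_comp_pre i (𝟙 _), homotopic_ihomSwap_iff,
    Category.assoc, Category.id_comp]
  simpa only [Category.comp_id] using hsurj.comp_left ((MonoidalClosed.pre i).app Z)

theorem exists_extension_of_isWeakEquiv [KanComplex Z] {i : A ⟶ B} [Mono i] (hi : IsWeakEquiv i)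
    (j : K ⟶ L) [Mono j] (a : A ⊗ L ⟶ Z) (b : B ⊗ K ⟶ Z) (hab : A ◁ j ≫ a = i ▷ K ≫ b) :
    ∃ χ : B ⊗ L ⟶ Z, i ▷ L ≫ χ = a ∧ B ◁ j ≫ χ = b := by
  have := (isHomotopyEquiv_pre (Z := Z) hi).rlp_monomorphisms j ‹_›
  have sq : CommSq (MonoidalClosed.curry b) j ((MonoidalClosed.pre i).app Z)
      (MonoidalClosed.curry a) :=
    ⟨by rw [MonoidalClosed.curry_pre_app, ← MonoidalClosed.curry_natural_left, hab]⟩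
  refine ⟨MonoidalClosed.uncurry sq.lift, ?_, ?_⟩
  · rw [← MonoidalClosed.curry_injective.eq_iff, ← MonoidalClosed.curry_pre_app,
      MonoidalClosed.curry_uncurry, sq.fac_right]
  · rw [← MonoidalClosed.uncurry_natural_left, sq.fac_left, MonoidalClosed.uncurry_curry]

/-! ### Right properness for Kan complexes -/

theorem exists_deformation_retraction [KanComplex Y] [KanComplex Z] {i : Y ⟶ Z}
    (hi : anodyneExtensions i) :
    ∃ (r : Z ⟶ Y) (R : Z ⊗ Δ[1] ⟶ Z), i ▷ _ ≫ R = fst _ _ ≫ i ∧ incl 0 Z ≫ R = r ≫ i ∧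
      incl 1 Z ≫ R = 𝟙 Z := by
  obtain ⟨r, hr⟩ := exists_extension_of_anodyneExtensions hi (𝟙 Y)
  have : Mono i := anodyneExtensions_le_monomorphisms _ hi
  obtain ⟨R, hR, hR'⟩ := exists_extension_of_isWeakEquiv (isWeakEquiv_of_anodyneExtensions hi)
    (boundary.{u} 1).ι (fst _ _ ≫ i) (boundaryDesc ![r ≫ i, 𝟙 Z])
    (hom_ext_boundary (Fin.forall_fin_two.2
      ⟨(show i = i ≫ r ≫ i by rw [reassoc_of% hr]), rfl⟩))
  rw [whiskerLeft_boundary_comp_eq_iff] at hR'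
  exact ⟨r, R, hR, hR' 0, hR' 1⟩

theorem isHomotopyEquiv_of_isPullback_anodyneExtensions [KanComplex Y] [KanComplex Z]
    {v : S ⟶ X} {v' : S ⟶ Y} {p : X ⟶ Z} {i : Y ⟶ Z} [Fibration p] (hi : anodyneExtensions i)
    (sq : IsPullback v v' p i) : IsHomotopyEquiv v := by
  obtain ⟨r, R, hR, hR₀, hR₁⟩ := exists_deformation_retraction hi
  have : Mono i := anodyneExtensions_le_monomorphisms _ hi
  have : Mono v := MorphismProperty.of_isPullback sq.flip
    (MorphismProperty.monomorphisms.infer_property i)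
  have hvR : (fst S Δ[1] ≫ v) ≫ p = v ▷ _ ≫ p ▷ _ ≫ R := by
    rw [← comp_whiskerRight_assoc, sq.w, comp_whiskerRight_assoc, hR, Category.assoc, sq.w]
    rfl
  obtain ⟨H, hH₁, hH₂, hH₃⟩ := exists_homotopy_lift 1 v p (𝟙 X) (fst _ _ ≫ v) (p ▷ _ ≫ R) rfl hvR
    (congrArg (p ≫ ·) hR₁)
  have hH₀ : (incl 0 X ≫ H) ≫ p = (p ≫ r) ≫ i := by
    rw [Category.assoc, hH₃, Category.assoc]
    exact congrArg (p ≫ ·) hR₀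
  refine ⟨sq.lift _ _ hH₀, ?_, ⟨H, (sq.lift_fst _ _ hH₀).symm, hH₂⟩⟩
  have : v ≫ sq.lift _ _ hH₀ = 𝟙 S := by
    rw [← cancel_mono v, Category.assoc, sq.lift_fst, Category.id_comp]
    exact congrArg (incl 0 S ≫ ·) hH₁
  rw [this]
  exact .refl _

theorem isWeakEquiv_of_isPullback [KanComplex X] [KanComplex Y] [KanComplex Z] {v : S ⟶ X}
    {v' : S ⟶ Y} {p : X ⟶ Z} {b : Y ⟶ Z} [Fibration p] (hb : IsWeakEquiv b)
    (sq : IsPullback v v' p b) : IsWeakEquiv v := by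
  let F := MorphismProperty.factorizationData J.{u}.rlp.llp J.{u}.rlp b
  have hi : anodyneExtensions F.i := F.hi
  have : Fibration F.p := (modelCategoryQuillen.fibration_iff _).2 F.hp
  have : KanComplex F.Z := isFibrant_of_fibration F.p
  have hp : IsHomotopyEquiv F.p := isHomotopyEquiv_of_isWeakEquiv
    (isWeakEquiv_of_comp_left (isWeakEquiv_of_anodyneExtensions hi) (by rwa [F.fac]))
  have sqp := IsPullback.of_hasPullback p F.p
  have hfst : IsHomotopyEquiv (pullback.fst p F.p) := isHomotopyEquiv_of_rlp_monomorphisms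
    (MorphismProperty.of_isPullback sqp.flip hp.rlp_monomorphisms)
  have : Fibration (pullback.snd p F.p) := (modelCategoryQuillen.fibration_iff _).2
    (MorphismProperty.of_isPullback sqp ((modelCategoryQuillen.fibration_iff p).1 inferInstance))
  have sqi := IsPullback.of_right' (h₂₁ := F.i) (h₂₂ := F.p) (by rwa [F.fac]) sqp
  have hv := isWeakEquiv_comp
    (isHomotopyEquiv_of_isPullback_anodyneExtensions hi sqi).isWeakEquiv hfst.isWeakEquiv
  rwa [sqp.lift_fst] at hv

theorem isWeakEquiv_whiskerRight {f : X ⟶ Y} (hf : IsWeakEquiv f) (L : SSet.{u}) :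
    IsWeakEquiv (f ▷ L) := by
  refine (isWeakEquiv_iff _).2 fun Z _ => ?_
  obtain ⟨hinj, hsurj⟩ := (isWeakEquiv_iff f).1 hf ((ihom L).obj Z) inferInstance
  have curry_comp (b : Y ⊗ L ⟶ Z) : MonoidalClosed.curry ((β_ L X).hom ≫ f ▷ L ≫ b) =
      f ≫ MonoidalClosed.curry ((β_ L Y).hom ≫ b) := by
    rw [← MonoidalClosed.curry_natural_left, BraidedCategory.braiding_naturality_right_assoc]
  refine ⟨fun b b' h => ?_, fun a => ?_⟩
  · rw [← homotopic_braiding_iff, ← homotopic_curry_iff]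
    apply hinj
    rwa [← curry_comp, ← curry_comp, homotopic_curry_iff, homotopic_braiding_iff]
  · obtain ⟨b, hb⟩ := hsurj (MonoidalClosed.curry ((β_ L X).hom ≫ a))
    refine ⟨(β_ Y L).hom ≫ MonoidalClosed.uncurry b, ?_⟩
    rw [← homotopic_braiding_iff, ← homotopic_curry_iff, curry_comp]
    rwa [SymmetricCategory.symmetry_assoc, MonoidalClosed.curry_uncurry]

theorem isWeakEquiv_of_isPushout {i : A ⟶ B} [Mono i] {g : A ⟶ X} {h : B ⟶ Y} {i' : X ⟶ Y}
    (sq : IsPushout i g h i') (hi : IsWeakEquiv i) : IsWeakEquiv i' := by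
  refine isWeakEquiv_of_exists_extension (fun Z _ a => ?_) fun Z _ H b hb => ?_
  · obtain ⟨χ, hχ, -⟩ := exists_extension_of_isWeakEquiv hi (⊥ : Subcomplex Δ[1]).ι
      (fst A Δ[1] ≫ g ≫ a) (ofFun (fun _ x => x.2.2.elim) fun _ x => x.2.2.elim)
      (hom_ext_apply fun _ x => x.2.2.elim)
    have hχ' : i ≫ incl 0 B ≫ χ = g ≫ a := congrArg (incl 0 A ≫ ·) hχ
    exact ⟨sq.desc _ a hχ', sq.inr_desc _ _ _⟩
  · obtain ⟨χ, h₁, h₂⟩ := exists_extension_of_isWeakEquiv hi (boundary.{u} 1).ι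
      (g ▷ Δ[1] ≫ H) (boundaryDesc fun ε => h ≫ b ε) (hom_ext_boundary fun ε => by
        change g ≫ incl ε X ≫ H = i ≫ h ≫ b ε
        rw [hb, sq.w_assoc])
    have sq' := sq.map (tensorRight Δ[1])
    rw [whiskerLeft_boundary_comp_eq_iff] at h₂
    refine ⟨sq'.desc χ H h₁, fun ε => sq.hom_ext ?_ ?_⟩
    · rw [← h₂]
      exact congrArg (incl ε B ≫ ·) (sq'.inl_desc χ H h₁)
    · rw [← hb]
      exact congrArg (incl ε X ≫ ·) (sq'.inr_desc χ H h₁)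

/-! ### Simplices of internal homs -/

/-- The value at `(θ, x)` of a `k`-simplex `a` of the internal hom, seen as a map
`Δ[k] × L → Y`. -/
abbrev ihomEval {k : SimplexCategoryᵒᵖ} (a : ((ihom L).obj Y).obj k) (l : SimplexCategoryᵒᵖ)
    (θ : k ⟶ l) (x : L.obj l) : Y.obj l :=
  Functor.HomObj.app a l θ x

/-- The simplex of the internal hom with the given values. -/
def ihomMk {k : SimplexCategoryᵒᵖ} (F : ∀ l, (k ⟶ l) → L.obj l → Y.obj l)
    (nat : ∀ {l m : SimplexCategoryᵒᵖ} (η : l ⟶ m) (θ : k ⟶ l) (x : L.obj l),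
      F m (θ ≫ η) (L.map η x) = Y.map η (F l θ x)) : ((ihom L).obj Y).obj k where
  app l θ := ↾fun x => F l θ x
  naturality {l m} η θ := by
    ext x
    exact nat η θ x

theorem ihom_ext {k : SimplexCategoryᵒᵖ} {a b : ((ihom L).obj Y).obj k}
    (h : ∀ l θ x, ihomEval a l θ x = ihomEval b l θ x) : a = b := by
  refine Functor.HomObj.ext (funext fun l => funext fun θ => ?_)
  ext x
  exact h l θ x

theorem ihomEval_map {k : SimplexCategoryᵒᵖ} (a : ((ihom L).obj Y).obj k)
    {l m : SimplexCategoryᵒᵖ} (η : l ⟶ m) (θ : k ⟶ l) (x : L.obj l) :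
    ihomEval a m (θ ≫ η) (L.map η x) = Y.map η (ihomEval a l θ x) :=
  ConcreteCategory.congr_hom (Functor.HomObj.naturality a η θ) x

theorem ihomEval_map_id {k l : SimplexCategoryᵒᵖ} (a : ((ihom L).obj Y).obj k) (θ : k ⟶ l)
    (x : L.obj k) :
    ihomEval (((ihom L).obj Y).map θ a) l (𝟙 l) (L.map θ x) = Y.map θ (ihomEval a k (𝟙 k) x) :=
  (congrArg (ihomEval a l · (L.map θ x))
    ((Category.comp_id θ).trans (Category.id_comp θ).symm)).trans (ihomEval_map a θ (𝟙 k) x)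

/-- The exchange of variables in the twofold internal hom. -/
def ihomFlip (L K Y : SSet.{u}) :
    (ihom L).obj ((ihom K).obj Y) ⟶ (ihom K).obj ((ihom L).obj Y) :=
  ofFun
    (fun _ F => ihomMk
      (fun _ θ t => ihomMk
        (fun m η x => ihomEval (ihomEval F m (θ ≫ η) x) m (𝟙 m) (K.map η t))
        (fun {m m'} ξ η x => by
          rw [Functor.map_comp_apply, ← Category.assoc, ihomEval_map F ξ (θ ≫ η) x]
          exact ihomEval_map_id (ihomEval F m (θ ≫ η) x) ξ (K.map η t)))
      (fun ξ θ t => ihom_ext fun m η x => by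
        change ihomEval (ihomEval F m ((θ ≫ ξ) ≫ η) x) m (𝟙 m) (K.map η (K.map ξ t)) =
          ihomEval (ihomEval F m (θ ≫ ξ ≫ η) x) m (𝟙 m) (K.map (ξ ≫ η) t)
        rw [Category.assoc, Functor.map_comp_apply]))
    (fun {k l} θ F => ihom_ext fun m η t => ihom_ext fun m' ξ x =>
      congrArg (fun ω => ihomEval (ihomEval F m' ω x) m' (𝟙 m') (K.map ξ t))
        (Category.assoc θ η ξ).symm)

@[simp]
theorem ihomFlip_comp_ihomFlip : ihomFlip L K Y ≫ ihomFlip K L Y = 𝟙 _ := by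
  refine hom_ext_apply fun k F => ihom_ext fun l θ x => ihom_ext fun m η t => ?_
  change ihomEval (ihomEval F m ((θ ≫ η) ≫ 𝟙 m) (L.map η x)) m (𝟙 m) (K.map (𝟙 m) t) = _
  rw [Category.comp_id, Functor.map_id_apply, ihomEval_map]
  exact congrArg (ihomEval (ihomEval F l θ x) m · t) (Category.comp_id η)

end SimplicialHomotopy

namespace PSSet

open SSet SimplicialHomotopy Simplicial HomotopicalAlgebra modelCategoryQuillen Limits
open CartesianMonoidalCategory

theorem hom_ext_apply {X Y : PSSet.{u}} {f g : X ⟶ Y}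
    (h : ∀ k x, Hom.ap f k x = Hom.ap g k x) : f = g :=
  Hom.ext (SimplicialHomotopy.hom_ext_apply h)

theorem Hom.ap_map {X Y : PSSet.{u}} (f : X ⟶ Y) {k l : SimplexCategoryᵒᵖ} (θ : k ⟶ l)
    (x : X.S k) : Hom.ap f l (X.toSSet.map θ x) = Y.toSSet.map θ (Hom.ap f k x) :=
  NatTrans.naturality_apply (Hom.hom f) θ x

/-- The base point, as a map from the terminal simplicial set. -/
def basePoint (X : PSSet.{u}) : 𝟙_ SSet.{u} ⟶ X.toSSet :=
  ofFun (fun k _ => X.pt k) (fun θ _ => (X.map_pt θ).symm)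

theorem basePoint_comp {X Y : PSSet.{u}} (f : X ⟶ Y) :
    basePoint X ≫ Hom.hom f = basePoint Y :=
  SimplicialHomotopy.hom_ext_apply fun k _ => Hom.app_pt f k

theorem glue.hom_ext {A Y Z : PSSet.{u}} {f : A ⟶ Y} {g : A ⟶ Z} {T : SSet.{u}}
    {p q : (glue f g).toSSet ⟶ T} (hl : Hom.hom (glue.inl f g) ≫ p = Hom.hom (glue.inl f g) ≫ q)
    (hr : Hom.hom (glue.inr f g) ≫ p = Hom.hom (glue.inr f g) ≫ q) : p = q :=
  SimplicialHomotopy.hom_ext_apply fun k => by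
    rintro ⟨y | z⟩
    · exact congr_apply hl k y
    · exact congr_apply hr k z

/-- The simplex `x ∧ a` of `X ∧ L₊`. -/
def smash.mkPlus {X : PSSet.{u}} {L : SSet.{u}} {k : SimplexCategoryᵒᵖ} (x : X.S k)
    (a : L.obj k) : (smash X (plus L)).S k :=
  smash.mk (K := plus L) x (some a)

@[simp]
theorem smash.mkPlus_pt {X : PSSet.{u}} {L : SSet.{u}} {k : SimplexCategoryᵒᵖ} (a : L.obj k) :
    smash.mkPlus (X.pt k) a = (smash X (plus L)).pt k :=
  smash.mk_pt_left _

theorem smash.exists_mkPlus {X : PSSet.{u}} {L : SSet.{u}} {k : SimplexCategoryᵒᵖ}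
    (z : (smash X (plus L)).S k) :
    z = (smash X (plus L)).pt k ∨ ∃ x a, z = smash.mkPlus x a := by
  obtain ⟨x, _ | a⟩ := z
  · exact .inl (smash.mk_pt_right x)
  · exact .inr ⟨x, a, rfl⟩

/-- The map `X ∧ f : X ∧ K ⟶ X ∧ K'`. -/
def smash.mapRight (X : PSSet.{u}) {K K' : PSSet.{u}} (f : K ⟶ K') : smash X K ⟶ smash X K' :=
  homMk (fun k => smash.lift (fun x a => smash.mk x (Hom.ap f k a)) ((smash X K').pt k)
      (fun a => by simp) (fun x => by simp))
    (by
      rintro k l θ ⟨x, a⟩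
      exact congrArg (smash.mk _) (Hom.ap_map f θ a))
    (fun k => congrArg (smash.mk _) (Hom.app_pt f k))

/-- The map `K₊ ⟶ L₊` induced by `j : K ⟶ L`. -/
def plusMap {K L : SSet.{u}} (j : K ⟶ L) : plus K ⟶ plus L :=
  homMk (fun k => Option.map (j.app k))
    (by
      rintro k l θ (_ | a)
      · rfl
      · exact congrArg some (NatTrans.naturality_apply j θ a))
    (fun _ => rfl)

/-- The quotient map `X × L ⟶ X ∧ L₊`. -/
def toSmashPlus (X : PSSet.{u}) (L : SSet.{u}) : X.toSSet ⊗ L ⟶ (smash X (plus L)).toSSet :=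
  ofFun (fun _ x => smash.mkPlus x.1 x.2) (fun _ _ => rfl)

/-- The map out of `X ∧ L₊` determined by its composite with the quotient map `X × L ⟶ X ∧ L₊`
and by its value at the base point. -/
def smashPlusDesc {X : PSSet.{u}} {L Z : SSet.{u}} (F : X.toSSet ⊗ L ⟶ Z) (c : 𝟙_ SSet.{u} ⟶ Z)
    (h : basePoint X ▷ L ≫ F = fst (𝟙_ SSet.{u}) L ≫ c) : (smash X (plus L)).toSSet ⟶ Z :=
  ofFun (fun k => smash.lift
      (fun x a => Option.elim a (c.app k PUnit.unit) fun b => F.app k (x, b))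
      (c.app k PUnit.unit)
      (by
        rintro (_ | a)
        · rfl
        · exact congr_apply h k (PUnit.unit, a))
      (fun _ => rfl)) (by
    rintro k l θ ⟨x, _ | a⟩
    · exact NatTrans.naturality_apply c θ PUnit.unit
    · exact NatTrans.naturality_apply F θ ((x, a) : (X.toSSet ⊗ L).obj k))

theorem isPushout_toSmashPlus (X : PSSet.{u}) (L : SSet.{u}) :
    IsPushout (basePoint X ▷ L) (fst (𝟙_ SSet.{u}) L) (toSmashPlus X L)
      (basePoint (smash X (plus L))) where
  w := SimplicialHomotopy.hom_ext_apply fun _ a => smash.mkPlus_pt a.2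
  isColimit' := ⟨PushoutCocone.IsColimit.mk _
    (fun s => smashPlusDesc s.inl s.inr s.condition)
    (fun _ => rfl) (fun _ => rfl)
    fun s m hl hr => SimplicialHomotopy.hom_ext_apply fun k z => by
      rcases smash.exists_mkPlus z with rfl | ⟨x, a, rfl⟩
      · exact congr_apply hr k PUnit.unit
      · exact congr_apply hl k (x, a)⟩

theorem isPushout_smash_map_plus {X Y : PSSet.{u}} (f : X ⟶ Y) (L : SSet.{u}) :
    IsPushout (Hom.hom f ▷ L) (toSmashPlus X L) (toSmashPlus Y L)
      (Hom.hom (smash.map f (plus L))) := by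
  refine .of_left ?_ rfl (isPushout_toSmashPlus X L)
  rw [← comp_whiskerRight, basePoint_comp, basePoint_comp]
  exact isPushout_toSmashPlus Y L

theorem smash_map_plus_injective {X Y : PSSet.{u}} {f : X ⟶ Y}
    (hf : ∀ k, Function.Injective (Hom.ap f k)) (L : SSet.{u}) (k : SimplexCategoryᵒᵖ) :
    Function.Injective (Hom.ap (smash.map f (plus L)) k) := by
  have hfL : Mono (Hom.hom f ▷ L) := mono_iff_injective.2 fun k =>
    (hf k).prodMap Function.injective_id
  exact mono_iff_injective.1 (MorphismProperty.of_isPushout (P := .monomorphisms SSet.{u})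
    (isPushout_smash_map_plus f L).flip hfL) k

theorem isWeakEquiv_smash_map_plus {X Y : PSSet.{u}} {f : X ⟶ Y}
    (hinj : ∀ k, Function.Injective (Hom.ap f k)) (hf : IsWeakEquiv (Hom.hom f)) (L : SSet.{u}) :
    IsWeakEquiv (Hom.hom (smash.map f (plus L))) :=
  have : Mono (Hom.hom f ▷ L) := mono_iff_injective.2 fun k =>
    (hinj k).prodMap Function.injective_id
  isWeakEquiv_of_isPushout (isPushout_smash_map_plus f L) (isWeakEquiv_whiskerRight hf L)

theorem anodyneExtensions_glue_desc_smash {A B : PSSet.{u}} (i : A ⟶ B)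
    (hi : ∀ k, Function.Injective (Hom.ap i k)) {K L : SSet.{u}} {j : K ⟶ L}
    (hj : anodyneExtensions j)
    (h : ∀ k a, Hom.ap (smash.map i (plus L)) k (Hom.ap (smash.mapRight A (plusMap j)) k a) =
      Hom.ap (smash.mapRight B (plusMap j)) k (Hom.ap (smash.map i (plus K)) k a)) :
    anodyneExtensions (Hom.hom (glue.desc (smash.map i (plus L))
      (smash.mapRight B (plusMap j)) h)) := by
  have : Mono (Hom.hom i) := mono_iff_injective.2 hi
  intro S T p hp
  have : Fibration p := (HomotopicalAlgebra.fibration_iff p).2 hp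
  refine ⟨fun {t b} sq => ?_⟩
  let inl := glue.inl (smash.mapRight A (plusMap j)) (smash.map i (plus K))
  let inr := glue.inr (smash.mapRight A (plusMap j)) (smash.map i (plus K))
  have hglue : toSmashPlus A K ≫ Hom.hom (smash.mapRight A (plusMap j)) ≫ Hom.hom inl =
      toSmashPlus A K ≫ Hom.hom (smash.map i (plus K)) ≫ Hom.hom inr :=
    SimplicialHomotopy.hom_ext_apply fun k x => glue.condition k (smash.mkPlus x.1 x.2)
  have hl : Hom.hom inl ≫ t ≫ p = Hom.hom (smash.map i (plus L)) ≫ b :=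
    congrArg (Hom.hom inl ≫ ·) sq.w
  have hr : Hom.hom inr ≫ t ≫ p = Hom.hom (smash.mapRight B (plusMap j)) ≫ b :=
    congrArg (Hom.hom inr ≫ ·) sq.w
  obtain ⟨χ, h₁, h₂, h₃⟩ := exists_lift_pushoutProduct (Hom.hom i) hj p
    (toSmashPlus A L ≫ Hom.hom inl ≫ t) (toSmashPlus B K ≫ Hom.hom inr ≫ t) (toSmashPlus B L ≫ b)
    (congrArg (· ≫ t) hglue) (congrArg (toSmashPlus A L ≫ ·) hl)
    (congrArg (toSmashPlus B K ≫ ·) hr)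
  have po := isPushout_smash_map_plus i L
  let lift := po.desc χ (Hom.hom inl ≫ t) h₁
  have lift_left : Hom.hom (smash.map i (plus L)) ≫ lift = Hom.hom inl ≫ t := po.inr_desc _ _ _
  have lift_right : Hom.hom (smash.mapRight B (plusMap j)) ≫ lift = Hom.hom inr ≫ t := by
    refine (isPushout_toSmashPlus B K).hom_ext ?_ ?_
    · rw [← h₂, ← po.inl_desc χ (Hom.hom inl ≫ t) h₁]
      rfl
    · rw [← Category.assoc, basePoint_comp, ← basePoint_comp (smash.map i (plus L)),
        Category.assoc, lift_left, ← Category.assoc, ← Category.assoc, basePoint_comp,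
        basePoint_comp]
  refine ⟨⟨⟨lift, glue.hom_ext lift_left lift_right, po.hom_ext ?_ ?_⟩⟩⟩
  · rw [po.inl_desc_assoc, h₃]
  · rw [po.inr_desc_assoc, Category.assoc, hl]

instance kanComplex_loops (Y : PSSet.{u}) [KanComplex Y.toSSet] : KanComplex (loops Y).toSSet := by
  refine kanComplex_of_exists_extension fun n i σ => ?_
  have : Mono circle.{u}.basePoint := mono_iff_injective.2 fun _ _ _ _ => rfl
  obtain ⟨χ, h₁, h₂⟩ := exists_extension_pushoutProduct circle.basePoint
    (anodyneExtensions.horn_ι i) (toUnit _ ≫ Y.basePoint) (MonoidalClosed.uncurry (σ ≫ (loops Y).ι))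
    (SimplicialHomotopy.hom_ext_apply fun k x => ((σ.app k x.2).2 k (𝟙 k)).symm)
  have h : Subcomplex.range (MonoidalClosed.curry χ) ≤ loops Y := by
    rintro k _ ⟨x, rfl⟩ l θ
    exact congr_apply h₁ l (PUnit.unit, (Δ[n + 1] : SSet.{u}).map θ x)
  refine ⟨Subcomplex.lift _ h, (cancel_mono (loops Y).ι).1 ?_⟩
  rw [Category.assoc, Subcomplex.lift_ι, ← MonoidalClosed.curry_natural_left, h₂,
    MonoidalClosed.curry_uncurry]

/-- The pointed simplicial set `Y ^ L` of maps from `L` to `Y`. -/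
def cotensor (Y : PSSet.{u}) (L : SSet.{u}) : PSSet.{u} where
  toSSet := (ihom L).obj Y.toSSet
  pt _ := ihomMk (fun l _ _ => Y.pt l) (fun η _ _ => (map_pt Y η).symm)
  map_pt _ := rfl

theorem range_ihom_map_loops_le (Y : PSSet.{u}) (L : SSet.{u}) :
    Subcomplex.range ((ihom L).map (loops Y).ι ≫ ihomFlip L circle.toSSet Y.toSSet) ≤
      loops (Y.cotensor L) := by
  rintro k _ ⟨a, rfl⟩ l θ
  refine ihom_ext fun m η x => ?_
  exact (congrArg (ihomEval (ihomEval a m (θ ≫ η) x).1 m (𝟙 m)) (circle.map_pt η)).trans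
    ((ihomEval a m (θ ≫ η) x).2 m (𝟙 m))

/-- The isomorphism `Map_*(S¹, Y) ^ L ≅ Map_*(S¹, Y ^ L)`. -/
def loopsCotensorIso (Y : PSSet.{u}) (L : SSet.{u}) :
    (ihom L).obj (loops Y).toSSet ≅ (loops (Y.cotensor L)).toSSet where
  hom := Subcomplex.lift _ (range_ihom_map_loops_le Y L)
  inv := ofFun
    (fun k b => ihomMk
      (fun l θ x => ⟨ihomEval ((ihomFlip circle.toSSet L Y.toSSet).app k b.1) l θ x,
        fun m η => congrArg (ihomEval (Y := Y.toSSet) · m (𝟙 m) (L.map η x)) (b.2 m (θ ≫ η))⟩)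
      (fun η θ x => Subtype.ext (ihomEval_map ((ihomFlip circle.toSSet L Y.toSSet).app k b.1)
        η θ x)))
    (fun θ b => ihom_ext fun l η x => Subtype.ext (by
      have h := NatTrans.naturality_apply (ihomFlip circle.toSSet L Y.toSSet) θ b.1
      exact congrArg (ihomEval · l η x) h))
  hom_inv_id := SimplicialHomotopy.hom_ext_apply fun k a => ihom_ext fun l θ x => Subtype.ext
    (congrArg (ihomEval · l θ x)
      (congr_apply ihomFlip_comp_ihomFlip k (((ihom L).map (loops Y).ι).app k a)))
  inv_hom_id := SimplicialHomotopy.hom_ext_apply fun k b => Subtype.ext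
    (congr_apply ihomFlip_comp_ihomFlip k b.1)

variable {X K : PSSet.{u}} {k : SimplexCategoryᵒᵖ} {x y : X.S k} {a b : K.S k}

theorem smash.mk_eq_pt (h : x = X.pt k ∨ a = K.pt k) : smash.mk x a = (smash X K).pt k := by
  rcases h with rfl | rfl
  · exact smash.mk_pt_left a
  · exact smash.mk_pt_right x

open Classical in
theorem smash.mk_eq_mk_iff : smash.mk x a = smash.mk y b ↔
    (x = y ∧ a = b) ∨ ((x = X.pt k ∨ a = K.pt k) ∧ (y = X.pt k ∨ b = K.pt k)) := by
  constructor
  · intro h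
    let F : (smash X K).S k → Option (X.S k × K.S k) :=
      smash.lift (fun x a => if x = X.pt k ∨ a = K.pt k then none else some (x, a)) none
        (fun a => if_pos (.inl rfl)) (fun x => if_pos (.inr rfl))
    have hF : (if x = X.pt k ∨ a = K.pt k then none else some (x, a)) =
        if y = X.pt k ∨ b = K.pt k then none else some (y, b) := congrArg F h
    split_ifs at hF with h₁ h₂ h₂
    · exact .inr ⟨h₁, h₂⟩
    · exact .inl (Prod.mk.inj (Option.some.inj hF))
  · rintro (⟨rfl, rfl⟩ | ⟨h₁, h₂⟩)
    · rfl
    · rw [smash.mk_eq_pt h₁, smash.mk_eq_pt h₂]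

end PSSet

namespace SymSpec

open PSSet SSet SimplicialHomotopy Simplicial HomotopicalAlgebra modelCategoryQuillen Limits

theorem hom_ext_apply {X Y : SymSpec.{u}} {f g : X ⟶ Y} (h : ∀ n k x, ap f n k x = ap g n k x) :
    f = g :=
  Hom.ext (funext fun n => PSSet.hom_ext_apply (h n))

theorem congr_ap {X Y : SymSpec.{u}} {f g : X ⟶ Y} (h : f = g) (n : ℕ) (k : SimplexCategoryᵒᵖ)
    (x : (X.lvl n).S k) : ap f n k x = ap g n k x := by
  rw [h]

/-- Maps `X × L → E` that are maps of symmetric spectra in the first variable. They correspond to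
maps `X ∧ L₊ ⟶ E`. -/
@[ext]
structure ParamHom (X : SymSpec.{u}) (L : SimplexCategoryᵒᵖ ⥤ Type v) (E : SymSpec.{u}) where
  app : ∀ n k, (X.lvl n).S k → L.obj k → (E.lvl n).S k
  app_map : ∀ n {k l : SimplexCategoryᵒᵖ} (θ : k ⟶ l) x a,
    app n l ((X.lvl n).toSSet.map θ x) (L.map θ a) = (E.lvl n).toSSet.map θ (app n k x a)
  app_pt : ∀ n k a, app n k ((X.lvl n).pt k) a = (E.lvl n).pt k
  app_act : ∀ n π k x a, app n k (PSSet.Hom.ap (X.act n π) k x) a =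
    PSSet.Hom.ap (E.act n π) k (app n k x a)
  app_susp : ∀ k n x t a, app (n + 1) k (X.susp k n x t) a = E.susp k n (app n k x a) t

namespace ParamHom

variable {X Y E : SymSpec.{u}}

theorem ext_apply {L : SimplexCategoryᵒᵖ ⥤ Type v} {φ ψ : ParamHom X L E}
    (h : ∀ n k x a, φ.app n k x a = ψ.app n k x a) : φ = ψ :=
  ParamHom.ext (funext fun n => funext fun k => funext fun x => funext fun a => h n k x a)

theorem congr_app {L : SimplexCategoryᵒᵖ ⥤ Type v} {φ ψ : ParamHom X L E} (h : φ = ψ) (n : ℕ)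
    (k : SimplexCategoryᵒᵖ) (x : (X.lvl n).S k) (a : L.obj k) :
    φ.app n k x a = ψ.app n k x a := by
  rw [h]

/-- Precomposition in the second variable. -/
def precomp {L : SimplexCategoryᵒᵖ ⥤ Type v} {K : SimplexCategoryᵒᵖ ⥤ Type w} (φ : ParamHom X L E)
    (j : ∀ k, K.obj k → L.obj k)
    (hj : ∀ {k l : SimplexCategoryᵒᵖ} (θ : k ⟶ l) a, j l (K.map θ a) = L.map θ (j k a)) :
    ParamHom X K E where
  app n k x a := φ.app n k x (j k a)
  app_map n k l θ x a := by rw [hj, φ.app_map]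
  app_pt n k a := φ.app_pt n k _
  app_act n π k x a := φ.app_act n π k x _
  app_susp k n x t a := φ.app_susp k n x t _

/-- Restriction along a map of simplicial sets. -/
def res {K L : SSet.{u}} (φ : ParamHom X L E) (j : K ⟶ L) : ParamHom X K E :=
  φ.precomp (fun k => j.app k) (fun θ a => NatTrans.naturality_apply j θ a)

/-- Precomposition with a map of symmetric spectra. -/
def pre {L : SimplexCategoryᵒᵖ ⥤ Type v} (f : X ⟶ Y) (φ : ParamHom Y L E) : ParamHom X L E where
  app n k x a := φ.app n k (ap f n k x) a
  app_map n k l θ x a := by rw [ap, PSSet.Hom.ap_map, φ.app_map]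
  app_pt n k a :=
    (congrArg (φ.app n k · a) (PSSet.Hom.app_pt (Hom.lvl f n) k)).trans (φ.app_pt n k a)
  app_act n π k x a := by rw [ap, Hom.lvl_act, φ.app_act]
  app_susp k n x t a := by rw [ap, Hom.lvl_susp, φ.app_susp]

/-- The map `X ⟶ E` at a vertex of `L`, given by its family of degenerate simplices. -/
def eval {L : SSet.{u}} (φ : ParamHom X L E) (a : ∀ k, L.obj k)
    (ha : ∀ {k l : SimplexCategoryᵒᵖ} (θ : k ⟶ l), L.map θ (a k) = a l) : X ⟶ E where
  lvl n := homMk (fun k x => φ.app n k x (a k))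
    (fun {k l} θ x => by rw [← φ.app_map, ha]) (fun k => φ.app_pt n k _)
  lvl_act n π k x := φ.app_act n π k x _
  lvl_susp k n x t := φ.app_susp k n x t _

/-- The map of symmetric spectra at the vertex `ε` of `Δ[1]`. -/
def atVertex (ε : Fin 2) (φ : ParamHom X Δ1.{u} E) : X ⟶ E :=
  φ.eval (fun k => stdSimplex.const 1 ε k) (map_const ε)

/-- A map of symmetric spectra, seen as a constant family. -/
def const (L : SimplexCategoryᵒᵖ ⥤ Type v) (f : X ⟶ E) : ParamHom X L E where
  app n k x _ := ap f n k x
  app_map _ _ _ θ x _ := PSSet.Hom.ap_map _ θ x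
  app_pt _ k _ := PSSet.Hom.app_pt _ k
  app_act n π k x _ := Hom.lvl_act f n π k x
  app_susp k n x t _ := Hom.lvl_susp f k n x t

/-- The map `X ∧ L₊ ⟶ E` given by a family. -/
def toSmash {L : SSet.{u}} (φ : ParamHom X L E) : X.smash (plus L) ⟶ E where
  lvl n := homMk (fun k => PSSet.smash.lift
      (fun x a => Option.elim a ((E.lvl n).pt k) fun b => φ.app n k x b) ((E.lvl n).pt k)
      (fun a => by cases a with
        | none => rfl
        | some a => exact φ.app_pt n k a) (fun _ => rfl))
    (by
      rintro k l θ ⟨x, _ | a⟩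
      · exact (map_pt _ θ).symm
      · exact φ.app_map n θ x a)
    (fun k => rfl)
  lvl_act := by
    rintro n π k ⟨x, _ | a⟩
    · exact (PSSet.Hom.app_pt _ k).symm
    · exact φ.app_act n π k x a
  lvl_susp := by
    rintro k n ⟨x, _ | a⟩ t
    · exact (E.susp_pt_left k n t).symm
    · exact φ.app_susp k n x t a

/-- The family given by a map `X ∧ L₊ ⟶ E`. -/
def ofSmash {L : SSet.{u}} (f : X.smash (plus L) ⟶ E) : ParamHom X L E where
  app n k x a := ap f n k (smash.mkPlus x a)
  app_map n k l θ x a := PSSet.Hom.ap_map (Hom.lvl f n) θ (smash.mkPlus x a)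
  app_pt n k a := by rw [smash.mkPlus_pt]; exact PSSet.Hom.app_pt (Hom.lvl f n) k
  app_act n π k x a := Hom.lvl_act f n π k (smash.mkPlus x a)
  app_susp k n x t a := Hom.lvl_susp f k n (smash.mkPlus x a) t

theorem ofSmash_toSmash {L : SSet.{u}} (φ : ParamHom X L E) : ofSmash φ.toSmash = φ := rfl

end ParamHom

theorem smashPlus_hom_ext {X E : SymSpec.{u}} {L : SSet.{u}} {f g : X.smash (plus L) ⟶ E}
    (h : ∀ n k x a, ap f n k (smash.mkPlus x a) = ap g n k (smash.mkPlus x a)) : f = g := by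
  refine hom_ext_apply fun n k z => ?_
  rcases smash.exists_mkPlus z with rfl | ⟨x, a, rfl⟩
  · exact (PSSet.Hom.app_pt (Hom.lvl f n) k).trans (PSSet.Hom.app_pt (Hom.lvl g n) k).symm
  · exact h n k x a

theorem homotopyRel_iff {X E : SymSpec.{u}} {f g : X ⟶ E} :
    HomotopyRel f g ↔ ∃ φ : ParamHom X Δ1 E, φ.atVertex 0 = f ∧ φ.atVertex 1 = g := by
  constructor
  · rintro ⟨H, rfl, rfl⟩
    exact ⟨.ofSmash H, rfl, rfl⟩
  · rintro ⟨φ, rfl, rfl⟩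
    exact ⟨φ.toSmash, rfl, rfl⟩

/-! ### Cotensors -/

/-- The structure maps of `E ^ L`. -/
def cotensorSusp (E : SymSpec.{u}) (L : SSet.{u}) (k : SimplexCategoryᵒᵖ) (n : ℕ)
    (a : ((E.lvl n).cotensor L).S k) (t : circle.{u}.S k) : ((E.lvl (n + 1)).cotensor L).S k :=
  ihomMk (fun l θ x => E.susp l n (ihomEval a l θ x) (circle.toSSet.map θ t))
    (fun {l m} η θ x => by
      rw [Functor.map_comp_apply, ← E.susp_nat]
      exact congrArg (E.susp m n · _) (ihomEval_map a η θ x))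

theorem ihomEval_iterSusp (E : SymSpec.{u}) (L : SSet.{u}) (k : SimplexCategoryᵒᵖ) (n p : ℕ)
    (a : ((E.lvl n).cotensor L).S k) (t : Fin p → circle.{u}.S k) (l : SimplexCategoryᵒᵖ)
    (θ : k ⟶ l) (x : L.obj l) :
    ihomEval (iterSusp (A := fun m => ((E.lvl m).cotensor L).S k) (cotensorSusp E L k) n p a t)
        l θ x =
      iterSusp (A := fun m => (E.lvl m).S l) (E.susp l) n p (ihomEval a l θ x)
        (fun i => circle.toSSet.map θ (t i)) := by
  induction p with
  | zero => rfl
  | succ p ih => exact congrArg (fun y => E.susp l (n + p) y _) (ih fun i => t i.castSucc)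

/-- The symmetric spectrum `E ^ L`, with levels `Eₙ ^ L`. -/
def cotensor (E : SymSpec.{u}) (L : SSet.{u}) : SymSpec.{u} where
  lvl n := (E.lvl n).cotensor L
  act n π := homMk (fun k a => ihomMk (fun l θ x => PSSet.Hom.ap (E.act n π) l (ihomEval a l θ x))
      (fun {l m} η θ x => by
        rw [← PSSet.Hom.ap_map]
        exact congrArg (PSSet.Hom.ap (E.act n π) m) (ihomEval_map a η θ x)))
    (fun _ _ => rfl) (fun k => ihom_ext fun l _ _ => PSSet.Hom.app_pt _ l)
  act_one n k a := ihom_ext fun l θ x => E.act_one n l (ihomEval a l θ x)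
  act_mul n π τ k a := ihom_ext fun l θ x => E.act_mul n π τ l (ihomEval a l θ x)
  susp := cotensorSusp E L
  susp_pt_left k n t := ihom_ext fun l θ _ => E.susp_pt_left l n _
  susp_pt_right k n a := ihom_ext fun l θ x =>
    (congrArg (E.susp l n _) (circle.map_pt θ)).trans (E.susp_pt_right l n _)
  susp_nat {k l} θ n a t := ihom_ext fun m η x =>
    congrArg (E.susp m n _) (Functor.map_comp_apply circle.toSSet θ η t).symm
  susp_equivariant k n p π τ a t := ihom_ext fun l θ x => by
    refine (ihomEval_iterSusp E L k n p _ _ l θ x).trans ?_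
    refine (E.susp_equivariant l n p π τ (ihomEval a l θ x)
      (fun i => circle.toSSet.map θ (t i))).trans ?_
    exact congrArg (PSSet.Hom.ap (E.act (n + p) (blockPerm π τ)) l)
      (ihomEval_iterSusp E L k n p a t l θ x).symm

namespace ParamHom

variable {X Y E : SymSpec.{u}}

/-- The map `X ⟶ E ^ L` given by a family. -/
def toCotensor {L : SSet.{u}} (φ : ParamHom X L E) : X ⟶ E.cotensor L where
  lvl n := homMk (Y := (E.lvl n).cotensor L)
    (fun k x => ihomMk (fun l θ a => φ.app n l ((X.lvl n).toSSet.map θ x) a)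
      (fun {l m} η θ a => by rw [Functor.map_comp_apply, φ.app_map]))
    (fun {k l} θ x => ihom_ext fun m η a =>
      congrArg (φ.app n m · a) (Functor.map_comp_apply (X.lvl n).toSSet θ η x).symm)
    (fun k => ihom_ext fun l θ a =>
      (congrArg (φ.app n l · a) (map_pt _ θ)).trans (φ.app_pt n l a))
  lvl_act n π k x := ihom_ext fun l θ a =>
    (congrArg (φ.app n l · a) (PSSet.Hom.ap_map (X.act n π) θ x).symm).trans
      (φ.app_act n π l ((X.lvl n).toSSet.map θ x) a)
  lvl_susp k n x t := ihom_ext fun l θ a =>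
    (congrArg (φ.app (n + 1) l · a) (X.susp_nat θ n x t).symm).trans
      (φ.app_susp l n ((X.lvl n).toSSet.map θ x) (circle.toSSet.map θ t) a)

/-- The family given by a map `X ⟶ E ^ L`. -/
def ofCotensor {L : SSet.{u}} (f : X ⟶ E.cotensor L) : ParamHom X L E where
  app n k x a := ihomEval (ap f n k x) k (𝟙 k) a
  app_map n k l θ x a := by
    refine (congrArg (ihomEval · l (𝟙 l) (L.map θ a)) (PSSet.Hom.ap_map (Hom.lvl f n) θ x)).trans ?_
    refine Eq.trans ?_ (ihomEval_map (ap f n k x) θ (𝟙 k) a)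
    exact congrArg (ihomEval (ap f n k x) l · (L.map θ a))
      ((Category.comp_id θ).trans (Category.id_comp θ).symm)
  app_pt n k a := congrArg (ihomEval · k (𝟙 k) a) (PSSet.Hom.app_pt (Hom.lvl f n) k)
  app_act n π k x a := congrArg (ihomEval · k (𝟙 k) a) (Hom.lvl_act f n π k x)
  app_susp k n x t a := by
    refine (congrArg (ihomEval · k (𝟙 k) a) (Hom.lvl_susp f k n x t)).trans ?_
    exact congrArg (E.susp k n _) (Functor.map_id_apply circle.toSSet k t)

theorem ofCotensor_toCotensor {L : SSet.{u}} (φ : ParamHom X L E) :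
    ofCotensor φ.toCotensor = φ :=
  ext_apply fun n k x a => congrArg (φ.app n k · a) (Functor.map_id_apply (X.lvl n).toSSet k x)

theorem toCotensor_ofCotensor {L : SSet.{u}} (f : X ⟶ E.cotensor L) :
    (ofCotensor f).toCotensor = f := by
  refine hom_ext_apply fun n k x => ihom_ext fun l θ a => ?_
  refine (congrArg (ihomEval · l (𝟙 l) a) (PSSet.Hom.ap_map (Hom.lvl f n) θ x)).trans ?_
  exact congrArg (ihomEval (ap f n k x) l · a) (Category.comp_id θ)

/-- The adjunction between `L × -` and `E ↦ E ^ L`, for families. -/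
def curry {L K : SSet.{u}} (φ : ParamHom X (L ⊗ K) E) : ParamHom X K (E.cotensor L) where
  app n k x s := ihomMk
    (fun l θ a => φ.app n l ((X.lvl n).toSSet.map θ x) (a, K.map θ s))
    (fun {l m} η θ a => by
      refine Eq.trans ?_ (φ.app_map n η ((X.lvl n).toSSet.map θ x) (a, K.map θ s))
      rw [Functor.map_comp_apply, Functor.map_comp_apply]
      rfl)
  app_map n k l θ x s := ihom_ext fun m η a => by
    exact congrArg₂ (fun y r => φ.app n m y (a, r))
      (Functor.map_comp_apply (X.lvl n).toSSet θ η x).symm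
      (Functor.map_comp_apply K θ η s).symm
  app_pt n k s := ihom_ext fun l θ a =>
    (congrArg (φ.app n l · (a, K.map θ s)) (map_pt _ θ)).trans (φ.app_pt n l _)
  app_act n π k x s := ihom_ext fun l θ a =>
    (congrArg (φ.app n l · (a, K.map θ s)) (PSSet.Hom.ap_map (X.act n π) θ x).symm).trans
      (φ.app_act n π l ((X.lvl n).toSSet.map θ x) _)
  app_susp k n x t s := ihom_ext fun l θ a =>
    (congrArg (φ.app (n + 1) l · (a, K.map θ s)) (X.susp_nat θ n x t).symm).trans
      (φ.app_susp l n ((X.lvl n).toSSet.map θ x) (circle.toSSet.map θ t) _)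

/-- The inverse of `ParamHom.curry`. -/
def uncurry {L K : SSet.{u}} (φ : ParamHom X K (E.cotensor L)) : ParamHom X (L ⊗ K) E where
  app n k x a := ihomEval (φ.app n k x a.2) k (𝟙 k) a.1
  app_map n k l θ x a := by
    refine (congrArg (ihomEval · l (𝟙 l) (L.map θ a.1)) (φ.app_map n θ x a.2)).trans ?_
    refine Eq.trans ?_ (ihomEval_map (φ.app n k x a.2) θ (𝟙 k) a.1)
    exact congrArg (ihomEval (φ.app n k x a.2) l · (L.map θ a.1))
      ((Category.comp_id θ).trans (Category.id_comp θ).symm)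
  app_pt n k a := congrArg (ihomEval · k (𝟙 k) a.1) (φ.app_pt n k a.2)
  app_act n π k x a := congrArg (ihomEval · k (𝟙 k) a.1) (φ.app_act n π k x a.2)
  app_susp k n x t a := by
    refine (congrArg (ihomEval · k (𝟙 k) a.1) (φ.app_susp k n x t a.2)).trans ?_
    exact congrArg (E.susp k n _) (Functor.map_id_apply circle.toSSet k t)

end ParamHom

/-! ### Mapping spaces -/

/-- The simplicial set of maps from `X` to `E`. -/
def mapSpace (X E : SymSpec.{u}) : SSet.{u} where
  obj k := ParamHom X (coyoneda.obj (Opposite.op k)) E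
  map θ := ↾fun φ => φ.precomp (fun _ η => θ ≫ η) (fun _ _ => (Category.assoc _ _ _).symm)
  map_id k := by
    ext φ n l x η
    change φ.app n l x (𝟙 k ≫ η) = φ.app n l x η
    rw [Category.id_comp]
  map_comp θ θ' := by
    ext φ n l x η
    change φ.app n l x ((θ ≫ θ') ≫ η) = φ.app n l x (θ ≫ θ' ≫ η)
    rw [Category.assoc]

/-- The map of mapping spaces induced by `f : X ⟶ Y`. -/
def mapSpacePre {X Y : SymSpec.{u}} (f : X ⟶ Y) (E : SymSpec.{u}) : mapSpace Y E ⟶ mapSpace X E :=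
  ofFun (fun _ φ => φ.pre f) (fun _ _ => rfl)

namespace ParamHom

variable {X Y E : SymSpec.{u}}

/-- The map to the mapping space given by a family. -/
def toMapSpace {L : SSet.{u}} (φ : ParamHom X L E) : L ⟶ mapSpace X E :=
  ofFun (fun _ a => φ.precomp (fun _ θ => L.map θ a)
      (fun θ η => Functor.map_comp_apply L η θ a))
    (fun θ a => ext_apply fun n k x η =>
      congrArg (φ.app n k x) (Functor.map_comp_apply L θ η a).symm)

/-- The family given by a map to the mapping space. -/
def ofMapSpace {L : SSet.{u}} (F : L ⟶ mapSpace X E) : ParamHom X L E where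
  app n k x a := (F.app k a : ParamHom X _ E).app n k x (𝟙 k)
  app_map n k l θ x a := by
    refine (congrArg (fun φ : ParamHom X _ E => φ.app n l _ (𝟙 l))
      (NatTrans.naturality_apply F θ a)).trans ?_
    refine Eq.trans ?_ ((F.app k a : ParamHom X _ E).app_map n θ x (𝟙 k))
    exact congrArg ((F.app k a : ParamHom X _ E).app n l _)
      ((Category.comp_id θ).trans (Category.id_comp θ).symm)
  app_pt n k a := (F.app k a : ParamHom X _ E).app_pt n k _
  app_act n π k x a := (F.app k a : ParamHom X _ E).app_act n π k x _
  app_susp k n x t a := (F.app k a : ParamHom X _ E).app_susp k n x t _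

theorem ofMapSpace_toMapSpace {L : SSet.{u}} (φ : ParamHom X L E) :
    ofMapSpace φ.toMapSpace = φ :=
  ext_apply fun n k x a => congrArg (φ.app n k x) (Functor.map_id_apply L k a)

theorem toMapSpace_ofMapSpace {L : SSet.{u}} (F : L ⟶ mapSpace X E) :
    (ofMapSpace F).toMapSpace = F := by
  refine SimplicialHomotopy.hom_ext_apply fun k a => ext_apply fun n l x θ => ?_
  refine (congrArg (fun φ : ParamHom X _ E => φ.app n l x (𝟙 l))
    (NatTrans.naturality_apply F θ a)).trans ?_
  exact congrArg ((F.app k a : ParamHom X _ E).app n l x) (Category.comp_id θ)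

theorem homotopic_toMapSpace_iff {L : SSet.{u}} {φ ψ : ParamHom X L E} :
    Homotopic φ.toMapSpace ψ.toMapSpace ↔
      ∃ Φ : ParamHom X (L ⊗ Δ1) E, Φ.res (incl 0 L) = φ ∧ Φ.res (incl 1 L) = ψ := by
  constructor
  · rintro ⟨H, h₀, h₁⟩
    refine ⟨ofMapSpace H, ?_, ?_⟩
    · exact (congrArg ofMapSpace h₀).trans (ofMapSpace_toMapSpace φ)
    · exact (congrArg ofMapSpace h₁).trans (ofMapSpace_toMapSpace ψ)
  · rintro ⟨Φ, rfl, rfl⟩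
    exact ⟨Φ.toMapSpace, rfl, rfl⟩

theorem homotopyRel_toCotensor_iff {L : SSet.{u}} {φ ψ : ParamHom X L E} :
    HomotopyRel φ.toCotensor ψ.toCotensor ↔ Homotopic φ.toMapSpace ψ.toMapSpace := by
  rw [homotopyRel_iff, homotopic_toMapSpace_iff]
  constructor
  · rintro ⟨Ψ, h₀, h₁⟩
    refine ⟨Ψ.uncurry, ?_, ?_⟩
    · exact (congrArg ofCotensor h₀).trans (ofCotensor_toCotensor φ)
    · exact (congrArg ofCotensor h₁).trans (ofCotensor_toCotensor ψ)
  · rintro ⟨Φ, rfl, rfl⟩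
    exact ⟨Φ.curry, rfl, rfl⟩

theorem pre_toCotensor {L : SSet.{u}} (f : X ⟶ Y) (φ : ParamHom Y L E) :
    (φ.pre f).toCotensor = f ≫ φ.toCotensor :=
  hom_ext_apply fun n _ x => ihom_ext fun l θ a =>
    congrArg (φ.app n l · a) (PSSet.Hom.ap_map (Hom.lvl f n) θ x)

end ParamHom

theorem IsInjective.cotensor {E : SymSpec.{u}} (hE : E.IsInjective) (L : SSet.{u}) :
    (E.cotensor L).IsInjective := by
  intro A B i hi hi' f
  obtain ⟨g, hg⟩ := hE _ _ (smashMap i (plus L))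
    (fun n k => smash_map_plus_injective (hi n) L k)
    (fun n => isWeakEquiv_smash_map_plus (hi n) (hi' n) L) (ParamHom.ofCotensor f).toSmash
  refine ⟨(ParamHom.ofSmash g).toCotensor, ?_⟩
  rw [← ParamHom.toCotensor_ofCotensor f, ← ParamHom.ofSmash_toSmash (ParamHom.ofCotensor f), ← hg]
  refine hom_ext_apply fun n k x => ihom_ext fun l θ a => ?_
  exact congrArg (fun y => ap g n l (smash.mkPlus y a)) (PSSet.Hom.ap_map (Hom.lvl i n) θ x).symm

theorem adjSusp_cotensor (E : SymSpec.{u}) (L : SSet.{u}) (n : ℕ) :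
    (E.cotensor L).adjSusp n =
      (ihom L).map (E.adjSusp n) ≫ (loopsCotensorIso (E.lvl (n + 1)) L).hom := by
  refine SimplicialHomotopy.hom_ext_apply fun k a =>
    Subtype.ext (ihom_ext fun l θ t => ihom_ext fun m η x => ?_)
  exact congrArg (E.susp m n · (circle.toSSet.map η t))
    (Functor.map_id_apply (E.lvl n).toSSet m (ihomEval a m (θ ≫ η) x)).symm

theorem IsOmega.cotensor {E : SymSpec.{u}} (hE : E.IsOmega) (L : SSet.{u}) :
    (E.cotensor L).IsOmega := by
  intro n
  have := (hE n).1
  have := (hE (n + 1)).1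
  refine ⟨inferInstanceAs (KanComplex ((ihom L).obj (E.lvl n).toSSet)), ?_⟩
  rw [adjSusp_cotensor]
  exact (((isHomotopyEquiv_of_isWeakEquiv (hE n).2).ihom_map L).comp_iso _).isWeakEquiv

/-- The map `X ∧ f`. -/
def smashMapRight (X : SymSpec.{u}) {K K' : PSSet.{u}} (f : K ⟶ K') : X.smash K ⟶ X.smash K' where
  lvl n := PSSet.smash.mapRight (X.lvl n) f
  lvl_act := by
    rintro n π k ⟨x, a⟩
    rfl
  lvl_susp := by
    rintro k n ⟨x, a⟩ t
    rfl

namespace IsInjective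

variable {A B E : SymSpec.{u}} {K L : SSet.{u}}

theorem exists_extension (hE : E.IsInjective) {i : A ⟶ B}
    (hi : ∀ n k, Function.Injective (ap i n k)) {j : K ⟶ L} (hj : anodyneExtensions j)
    (φ : ParamHom A L E) (ψ : ParamHom B K E) (h : φ.res j = ψ.pre i) :
    ∃ χ : ParamHom B L E, χ.pre i = φ ∧ χ.res j = ψ := by
  have w : A.smashMapRight (plusMap j) ≫ smashMap i (plus L) =
      smashMap i (plus K) ≫ B.smashMapRight (plusMap j) := smashPlus_hom_ext fun _ _ _ _ => rfl
  have hd (n : ℕ) : anodyneExtensions (PSSet.Hom.hom (Hom.lvl (glue.desc _ _ w) n)) :=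
    anodyneExtensions_glue_desc_smash (Hom.lvl i n) (hi n) hj fun k a => congr_ap w n k a
  obtain ⟨χ, hχ⟩ := hE _ _ (glue.desc _ _ w)
    (fun n => mono_iff_injective.1 (anodyneExtensions_le_monomorphisms _ (hd n)))
    (fun n => isWeakEquiv_of_anodyneExtensions (hd n))
    (glue.desc φ.toSmash ψ.toSmash (smashPlus_hom_ext fun n k x a => ParamHom.congr_app h n k x a))
  refine ⟨.ofSmash χ, ParamHom.ext_apply fun n k x a => ?_, ParamHom.ext_apply fun n k x a => ?_⟩
  · exact congr_ap hχ n k (ap (glue.inl _ _) n k (smash.mkPlus x a))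
  · exact congr_ap hχ n k (ap (glue.inr _ _) n k (smash.mkPlus x a))

theorem fibration_mapSpacePre (hE : E.IsInjective) {i : A ⟶ B}
    (hi : ∀ n k, Function.Injective (ap i n k)) : Fibration (mapSpacePre i E) := by
  refine fibration_of_exists_lift fun n m σ τ h => ?_
  obtain ⟨χ, h₁, h₂⟩ := hE.exists_extension hi (anodyneExtensions.horn_ι m)
    (ParamHom.ofMapSpace τ) (ParamHom.ofMapSpace σ) (congrArg ParamHom.ofMapSpace h).symm
  refine ⟨χ.toMapSpace, ?_, ?_⟩
  · exact (congrArg ParamHom.toMapSpace h₂).trans (ParamHom.toMapSpace_ofMapSpace σ)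
  · exact (congrArg ParamHom.toMapSpace h₁).trans (ParamHom.toMapSpace_ofMapSpace τ)

theorem kanComplex_mapSpace (hE : E.IsInjective) (X : SymSpec.{u}) :
    KanComplex (mapSpace X E) := by
  refine kanComplex_of_exists_extension fun n m σ => ?_
  obtain ⟨χ, -, h⟩ := hE.exists_extension (i := fromPoint X) (fun _ _ _ _ _ => rfl)
    (anodyneExtensions.horn_ι m) (ParamHom.const _ (fromPoint E)) (ParamHom.ofMapSpace σ)
    (ParamHom.ext_apply fun n k _ a => ((ParamHom.ofMapSpace σ).app_pt n k a).symm)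
  exact ⟨χ.toMapSpace, (congrArg ParamHom.toMapSpace h).trans (ParamHom.toMapSpace_ofMapSpace σ)⟩

end IsInjective

/-! ### Stable equivalences and mapping spaces -/

variable {X Y Z E : SymSpec.{u}}

/-- The vertex of the mapping space given by a map of symmetric spectra. -/
def mapSpaceVertex (f : X ⟶ E) : 𝟙_ SSet.{u} ⟶ mapSpace X E :=
  (ParamHom.const (𝟙_ SSet.{u}) f).toMapSpace

theorem mapSpaceVertex_surjective : Function.Surjective (mapSpaceVertex (X := X) (E := E)) :=
  fun F => ⟨(ParamHom.ofMapSpace F).eval (fun _ => PUnit.unit) (fun _ => rfl),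
    ParamHom.toMapSpace_ofMapSpace F⟩

theorem mapSpaceVertex_comp (f : X ⟶ Y) (g : Y ⟶ E) :
    mapSpaceVertex (f ≫ g) = mapSpaceVertex g ≫ mapSpacePre f E := rfl

theorem homotopyRel_iff_homotopic {f g : X ⟶ E} :
    HomotopyRel f g ↔ Homotopic (mapSpaceVertex f) (mapSpaceVertex g) := by
  rw [homotopyRel_iff, mapSpaceVertex, mapSpaceVertex, ParamHom.homotopic_toMapSpace_iff]
  constructor
  · rintro ⟨φ, rfl, rfl⟩
    exact ⟨φ.res (CartesianMonoidalCategory.snd _ _), rfl, rfl⟩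
  · rintro ⟨Φ, h₀, h₁⟩
    refine ⟨Φ.precomp (fun k s => (PUnit.unit, s)) (fun _ _ => rfl), ?_, ?_⟩
    · exact hom_ext_apply fun n k x => ParamHom.congr_app h₀ n k x PUnit.unit
    · exact hom_ext_apply fun n k x => ParamHom.congr_app h₁ n k x PUnit.unit

theorem IsInjective.E0_mk_eq_iff (hE : E.IsInjective) {f g : X ⟶ E} :
    (Quot.mk _ f : E0 E X) = Quot.mk _ g ↔ HomotopyRel f g := by
  have := hE.kanComplex_mapSpace X
  refine Equivalence.quot_mk_eq_iff (r := HomotopyRel) ⟨fun f => ?_, fun h => ?_, fun h h' => ?_⟩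
    f g <;> rw [homotopyRel_iff_homotopic] at *
  · exact .refl _
  · exact h.symm
  · exact h.trans h'

theorem IsStableEquiv.exists_homotopic_comp_mapSpacePre {f : X ⟶ Y} (hf : IsStableEquiv f)
    (hE : E.IsInjective) (hE' : E.IsOmega) {L : SSet.{u}} (F : L ⟶ mapSpace X E) :
    ∃ G : L ⟶ mapSpace Y E, Homotopic (G ≫ mapSpacePre f E) F := by
  obtain ⟨⟨g⟩, hg⟩ := (hf _ (hE.cotensor L) (hE'.cotensor L)).2
    (Quot.mk _ (ParamHom.ofMapSpace F).toCotensor)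
  refine ⟨(ParamHom.ofCotensor g).toMapSpace, ?_⟩
  have h : HomotopyRel ((ParamHom.ofCotensor g).pre f).toCotensor
      (ParamHom.ofMapSpace F).toCotensor := by
    rw [ParamHom.pre_toCotensor, ParamHom.toCotensor_ofCotensor]
    exact (hE.cotensor L).E0_mk_eq_iff.1 hg
  rw [ParamHom.homotopyRel_toCotensor_iff, ParamHom.toMapSpace_ofMapSpace] at h
  exact h

theorem IsStableEquiv.homotopic_of_comp_mapSpacePre {f : X ⟶ Y} (hf : IsStableEquiv f)
    (hE : E.IsInjective) (hE' : E.IsOmega) {L : SSet.{u}} {F G : L ⟶ mapSpace Y E}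
    (h : Homotopic (F ≫ mapSpacePre f E) (G ≫ mapSpacePre f E)) : Homotopic F G := by
  rw [← ParamHom.toMapSpace_ofMapSpace F, ← ParamHom.toMapSpace_ofMapSpace G] at h ⊢
  have h' : HomotopyRel ((ParamHom.ofMapSpace F).pre f).toCotensor
    ((ParamHom.ofMapSpace G).pre f).toCotensor := ParamHom.homotopyRel_toCotensor_iff.2 h
  rw [ParamHom.pre_toCotensor, ParamHom.pre_toCotensor] at h'
  have h'' := (hf _ (hE.cotensor L) (hE'.cotensor L)).1 (a₁ := Quot.mk _ _) (a₂ := Quot.mk _ _)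
    ((hE.cotensor L).E0_mk_eq_iff.2 h')
  exact ParamHom.homotopyRel_toCotensor_iff.1 ((hE.cotensor L).E0_mk_eq_iff.1 h'')

theorem IsStableEquiv.isHomotopyEquiv_mapSpacePre {f : X ⟶ Y} (hf : IsStableEquiv f)
    (hE : E.IsInjective) (hE' : E.IsOmega) : IsHomotopyEquiv (mapSpacePre f E) := by
  obtain ⟨g, hg⟩ := hf.exists_homotopic_comp_mapSpacePre hE hE' (𝟙 _)
  refine ⟨g, hf.homotopic_of_comp_mapSpacePre hE hE' ?_, hg⟩
  simpa using hg.comp_left (mapSpacePre f E)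

theorem E0_map_bijective {f : X ⟶ Y} (hE : E.IsInjective)
    (hf : IsHomotopyEquiv (mapSpacePre f E)) : Function.Bijective (E0.map E f) := by
  have := hE.kanComplex_mapSpace Y
  obtain ⟨G, h₁, h₂⟩ := hf
  constructor
  · rintro ⟨g⟩ ⟨g'⟩ h
    have h := (homotopyRel_iff_homotopic.1 (hE.E0_mk_eq_iff.1 h)).comp_right G
    rw [mapSpaceVertex_comp, mapSpaceVertex_comp, Category.assoc, Category.assoc] at h
    have e := h₁.comp_left (mapSpaceVertex g)
    have e' := h₁.comp_left (mapSpaceVertex g')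
    rw [Category.comp_id] at e e'
    exact Quot.sound (homotopyRel_iff_homotopic.2 (e.symm.trans (h.trans e')))
  · rintro ⟨g⟩
    obtain ⟨a, ha⟩ := mapSpaceVertex_surjective (mapSpaceVertex g ≫ G)
    refine ⟨Quot.mk _ a, Quot.sound (homotopyRel_iff_homotopic.2 ?_)⟩
    have h := h₂.comp_left (mapSpaceVertex g)
    rwa [Category.comp_id, ← Category.assoc, ← ha, ← mapSpaceVertex_comp] at h

/-- Only `E⁰`, that is `π₀ Map(-, E)`, enters the definition of stable equivalences; the cotensors
`E ^ L` bring in the rest of the mapping space, since `E ^ L` is an injective `Ω`-spectrum and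
`π₀ Map(X, E ^ L)` is the set of homotopy classes of maps `L ⟶ Map(X, E)`. -/
theorem isStableEquiv_iff {f : X ⟶ Y} : IsStableEquiv f ↔
    ∀ E : SymSpec.{u}, E.IsInjective → E.IsOmega → IsWeakEquiv (mapSpacePre f E) := by
  refine ⟨fun hf E hE hE' => (hf.isHomotopyEquiv_mapSpacePre hE hE').isWeakEquiv,
    fun hf E hE hE' => E0_map_bijective hE ?_⟩
  have := hE.kanComplex_mapSpace X
  have := hE.kanComplex_mapSpace Y
  exact isHomotopyEquiv_of_isWeakEquiv (hf E hE hE')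

theorem IsStableEquiv.comp {f : X ⟶ Y} {g : Y ⟶ Z} (hf : IsStableEquiv f)
    (hg : IsStableEquiv g) : IsStableEquiv (f ≫ g) :=
  isStableEquiv_iff.2 fun E hE hE' =>
    isWeakEquiv_comp (isStableEquiv_iff.1 hg E hE hE') (isStableEquiv_iff.1 hf E hE hE')

theorem IsStableEquiv.of_comp_left {f : X ⟶ Y} {g : Y ⟶ Z}
    (hf : IsStableEquiv f) (h : IsStableEquiv (f ≫ g)) : IsStableEquiv g :=
  isStableEquiv_iff.2 fun E hE hE' =>
    isWeakEquiv_of_comp_right (isStableEquiv_iff.1 hf E hE hE') (isStableEquiv_iff.1 h E hE hE')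

/-! ### Pushouts -/

variable {A T V W : SymSpec.{u}}

theorem glue.hom_ext {f : A ⟶ Y} {g : A ⟶ Z} {p q : glue f g ⟶ T}
    (h₁ : glue.inl f g ≫ p = glue.inl f g ≫ q) (h₂ : glue.inr f g ≫ p = glue.inr f g ≫ q) :
    p = q := by
  refine hom_ext_apply fun n k => ?_
  rintro ⟨y | z⟩
  · exact congr_ap h₁ n k y
  · exact congr_ap h₂ n k z

theorem isPushout_glue (f : A ⟶ Y) (g : A ⟶ Z) :
    IsPushout f g (glue.inl f g) (glue.inr f g) :=
  IsPushout.of_isColimit' ⟨glue.condition f g⟩ (PushoutCocone.IsColimit.mk _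
    (fun s => glue.desc s.inl s.inr s.condition) (fun _ => rfl) (fun _ => rfl)
    (fun _ _ h₁ h₂ => glue.hom_ext h₁ h₂))

/-- The adjunction between mapping spaces and cotensors: maps `L ⟶ Map(X, E)` correspond to maps
`X ⟶ E ^ L`. -/
def mapSpaceEquiv (L : SSet.{u}) (X E : SymSpec.{u}) : (L ⟶ mapSpace X E) ≃ (X ⟶ E.cotensor L) where
  toFun F := (ParamHom.ofMapSpace F).toCotensor
  invFun f := (ParamHom.ofCotensor f).toMapSpace
  left_inv F := by
    dsimp only
    rw [ParamHom.ofCotensor_toCotensor, ParamHom.toMapSpace_ofMapSpace]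
  right_inv f := by
    dsimp only
    rw [ParamHom.ofMapSpace_toMapSpace, ParamHom.toCotensor_ofCotensor]

theorem mapSpaceEquiv_comp_mapSpacePre {L : SSet.{u}} {E : SymSpec.{u}} (F : L ⟶ mapSpace Y E)
    (f : X ⟶ Y) :
    mapSpaceEquiv L X E (F ≫ mapSpacePre f E) = f ≫ mapSpaceEquiv L Y E F :=
  ParamHom.pre_toCotensor f (ParamHom.ofMapSpace F)

theorem isPullback_mapSpacePre {f : A ⟶ Y} {g : A ⟶ Z} {y : Y ⟶ V} {z : Z ⟶ V}
    (sq : IsPushout f g y z) (E : SymSpec.{u}) :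
    IsPullback (mapSpacePre y E) (mapSpacePre z E) (mapSpacePre f E) (mapSpacePre g E) := by
  have w (s : PullbackCone (mapSpacePre f E) (mapSpacePre g E)) :
      f ≫ mapSpaceEquiv _ Y E s.fst = g ≫ mapSpaceEquiv _ Z E s.snd := by
    rw [← mapSpaceEquiv_comp_mapSpacePre, ← mapSpaceEquiv_comp_mapSpacePre, s.condition]
  refine IsPullback.of_isLimit' ⟨congrArg (mapSpacePre · E) sq.w⟩ (PullbackCone.IsLimit.mk _
    (fun s => (mapSpaceEquiv _ V E).symm (sq.desc _ _ (w s))) (fun s => ?_) (fun s => ?_)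
    (fun s m h₁ h₂ => ?_))
  · apply (mapSpaceEquiv _ Y E).injective
    rw [mapSpaceEquiv_comp_mapSpacePre, Equiv.apply_symm_apply, sq.inl_desc]
  · apply (mapSpaceEquiv _ Z E).injective
    rw [mapSpaceEquiv_comp_mapSpacePre, Equiv.apply_symm_apply, sq.inr_desc]
  · rw [Equiv.eq_symm_apply]
    apply sq.hom_ext
    · rw [← mapSpaceEquiv_comp_mapSpacePre, h₁, sq.inl_desc]
    · rw [← mapSpaceEquiv_comp_mapSpacePre, h₂, sq.inr_desc]

theorem IsStableEquiv.cobaseChange_of_injective {f : A ⟶ Y} {g : A ⟶ Z} {y : Y ⟶ V} {z : Z ⟶ V}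
    (sq : IsPushout f g y z) (hf : IsStableEquiv f)
    (hf' : ∀ n k, Function.Injective (ap f n k)) : IsStableEquiv z :=
  isStableEquiv_iff.2 fun E hE hE' => by
    have := hE.kanComplex_mapSpace A
    have := hE.kanComplex_mapSpace Y
    have := hE.fibration_mapSpacePre hf'
    have hp := isHomotopyEquiv_of_isWeakEquiv (isStableEquiv_iff.1 hf E hE hE')
    exact (isHomotopyEquiv_of_rlp_monomorphisms (MorphismProperty.of_isPullback
      (isPullback_mapSpacePre sq E) hp.rlp_monomorphisms)).isWeakEquiv

/-- Left properness of the category of symmetric spectra. -/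
theorem IsStableEquiv.cobaseChange_along_injective {f : A ⟶ Y} {g : A ⟶ Z} {y : Y ⟶ V} {z : Z ⟶ V}
    (sq : IsPushout f g y z) (hf : ∀ n k, Function.Injective (ap f n k))
    (hg : IsStableEquiv g) : IsStableEquiv y :=
  isStableEquiv_iff.2 fun E hE hE' => by
    have := hE.kanComplex_mapSpace A
    have := hE.kanComplex_mapSpace Y
    have := hE.kanComplex_mapSpace Z
    have := hE.fibration_mapSpacePre hf
    exact isWeakEquiv_of_isPullback (isStableEquiv_iff.1 hg E hE hE') (isPullback_mapSpacePre sq E)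

open Classical in
theorem glue.inr_injective {f : A ⟶ Y} (g : A ⟶ Z)
    (hf : ∀ n k, Function.Injective (ap f n k)) (n : ℕ) (k : SimplexCategoryᵒᵖ) :
    Function.Injective (ap (glue.inr f g) n k) := by
  intro z z' h
  let G : (Y.lvl n).S k ⊕ (Z.lvl n).S k → Option ((Z.lvl n).S k) :=
    Sum.elim (fun y => if h : ∃ a, ap f n k a = y then some (ap g n k h.choose) else none) some
  have hG : ∀ p q, GlueRel (Hom.lvl f n) (Hom.lvl g n) k p q → G p = G q := by
    rintro _ _ ⟨a⟩
    have ha : ∃ a', ap f n k a' = ap f n k a := ⟨a, rfl⟩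
    refine (dif_pos ha).trans ?_
    rw [hf n k ha.choose_spec]
    rfl
  exact Option.some.inj (congrArg (Quot.lift G hG) h)

theorem glue.inl_injective (f : A ⟶ Y) {g : A ⟶ Z}
    (hg : ∀ n k, Function.Injective (ap g n k)) (n : ℕ) (k : SimplexCategoryᵒᵖ) :
    Function.Injective (ap (glue.inl f g) n k) := fun _ _ h =>
  glue.inr_injective f hg n k
    (congrArg (ap (glue.desc (glue.inr g f) (glue.inl g f) (glue.condition g f).symm) n k) h)

/-! ### Homotopy invariance -/

theorem E0_map_comp (E : SymSpec.{u}) (f : X ⟶ Y) (g : Y ⟶ Z) :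
    E0.map E (f ≫ g) = E0.map E f ∘ E0.map E g := by
  ext ⟨φ⟩
  exact congrArg (Quot.mk _) (Category.assoc f g φ)

theorem E0_map_id (E X : SymSpec.{u}) : E0.map E (𝟙 X) = id := by
  ext ⟨φ⟩
  exact congrArg (Quot.mk _) (Category.id_comp φ)

theorem HomotopyRel.E0_map_eq {f g : X ⟶ Y} (h : HomotopyRel f g) (E : SymSpec.{u}) :
    E0.map E f = E0.map E g := by
  obtain ⟨H, rfl, rfl⟩ := h
  ext ⟨φ⟩
  exact Quot.sound ⟨H ≫ φ, (Category.assoc _ _ _).symm, (Category.assoc _ _ _).symm⟩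

theorem isStableEquiv_of_deformation_retract {i : X ⟶ Y} {r : Y ⟶ X} (hi : i ≫ r = 𝟙 X)
    (h : HomotopyRel (𝟙 Y) (r ≫ i)) : IsStableEquiv i ∧ IsStableEquiv r := by
  have hir (E : SymSpec.{u}) : E0.map E i ∘ E0.map E r = id := by
    rw [← E0_map_comp, hi, E0_map_id]
  have hri (E : SymSpec.{u}) : E0.map E r ∘ E0.map E i = id := by
    rw [← E0_map_comp, ← h.E0_map_eq, E0_map_id]
  exact ⟨fun E _ _ => Function.bijective_iff_has_inverse.2 ⟨_, congrFun (hri E), congrFun (hir E)⟩,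
    fun E _ _ => Function.bijective_iff_has_inverse.2 ⟨_, congrFun (hir E), congrFun (hri E)⟩⟩

/-! ### Cones -/

theorem ap_eq_pt_iff {f : X ⟶ Y} {n : ℕ} {k : SimplexCategoryᵒᵖ}
    (hf : Function.Injective (ap f n k)) {x : (X.lvl n).S k} :
    ap f n k x = (Y.lvl n).pt k ↔ x = (X.lvl n).pt k :=
  (iff_of_eq (congrArg (ap f n k x = ·) (PSSet.Hom.app_pt (Hom.lvl f n) k).symm)).trans hf.eq_iff

theorem const_zero_ne_interval_pt (k : SimplexCategoryᵒᵖ) :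
    (stdSimplex.const 1 0 k : interval.{u}.S k) ≠ interval.pt k :=
  fun h => zero_ne_one (const_injective k h)

theorem coneIncl_injective (X : SymSpec.{u}) (n : ℕ) (k : SimplexCategoryᵒᵖ) :
    Function.Injective (ap (coneIncl X) n k) := by
  intro x y h
  rcases smash.mk_eq_mk_iff.1 h with ⟨h, -⟩ | ⟨h₁ | h₁, h₂ | h₂⟩
  · exact h
  · exact h₁.trans h₂.symm
  all_goals exact absurd ‹_› (const_zero_ne_interval_pt k)

theorem smashMap_injective {j : X ⟶ Y} (hj : ∀ n k, Function.Injective (ap j n k)) (K : PSSet.{u})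
    (n : ℕ) (k : SimplexCategoryᵒᵖ) : Function.Injective (ap (smashMap j K) n k) := by
  rintro ⟨x, a⟩ ⟨y, b⟩ h
  have h : smash.mk (ap j n k x) a = smash.mk (ap j n k y) b := h
  rw [smash.mk_eq_mk_iff, ap_eq_pt_iff (hj n k), ap_eq_pt_iff (hj n k), (hj n k).eq_iff,
    ← smash.mk_eq_mk_iff] at h
  exact h

/-- The map `Y ∪_X (X ∧ Δ[1]) ⟶ Y ∧ Δ[1]` from the homotopy cofiber of `j : X ⟶ Y` to the cone of
`Y`; for `j` injective it is the inclusion of the union of the base with the cone of `X`. -/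
def coneUnionDesc (j : X ⟶ Y) : cofiber j ⟶ Y.smash interval :=
  glue.desc (coneIncl Y) (smashMap j interval) rfl

theorem coneUnionDesc_injective {j : X ⟶ Y} (hj : ∀ n k, Function.Injective (ap j n k)) (n : ℕ)
    (k : SimplexCategoryᵒᵖ) : Function.Injective (ap (coneUnionDesc j) n k) := by
  have base_eq_cone (y : (Y.lvl n).S k) (x : (X.lvl n).S k) (s : interval.{u}.S k)
      (h : smash.mk y (stdSimplex.const 1 0 k : interval.{u}.S k) = smash.mk (ap j n k x) s) :
      ap (glue.inl j (coneIncl X)) n k y =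
        ap (glue.inr j (coneIncl X)) n k (smash.mk x s) := by
    rcases smash.mk_eq_mk_iff.1 h with ⟨rfl, rfl⟩ | ⟨h₁ | h₁, h₂⟩
    · exact congr_ap (glue.condition j (coneIncl X)) n k x
    · rw [h₁, smash.mk_eq_pt (h₂.imp_left (ap_eq_pt_iff (hj n k)).1)]
      exact (PSSet.Hom.app_pt (Hom.lvl (glue.inr j (coneIncl X)) n) k).symm
    · exact absurd h₁ (const_zero_ne_interval_pt k)
  rintro ⟨y | ⟨x, s⟩⟩ ⟨y' | ⟨x', s'⟩⟩ h
  · exact congrArg (ap (glue.inl j (coneIncl X)) n k) (coneIncl_injective Y n k h)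
  · exact base_eq_cone y x' s' h
  · exact (base_eq_cone y' x s h.symm).symm
  · exact congrArg (ap (glue.inr j (coneIncl X)) n k) (smashMap_injective hj interval n k h)

/-- The unique map `X ⟶ *`. -/
def toPoint (X : SymSpec.{u}) : X ⟶ point where
  lvl _ := homMk (fun _ _ => PUnit.unit) (fun _ _ => rfl) (fun _ => rfl)
  lvl_act _ _ _ _ := rfl
  lvl_susp _ _ _ _ := rfl

theorem eq_fromPoint (f : point ⟶ X) : f = fromPoint X :=
  hom_ext_apply fun n k _ => PSSet.Hom.app_pt (Hom.lvl f n) k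

/-- The pointwise maximum of two simplices of `Δ[1]`, seen as monotone maps `[k] → [1]`. -/
def maxSimplex {k : SimplexCategoryᵒᵖ} (s t : Δ1.{u}.obj k) : Δ1.{u}.obj k :=
  stdSimplex.objEquiv.symm (SimplexCategory.Hom.mk
    (stdSimplex.asOrderHom s ⊔ stdSimplex.asOrderHom t))

theorem delta1_ext {k : SimplexCategoryᵒᵖ} {s t : Δ1.{u}.obj k}
    (h : ∀ m, stdSimplex.asOrderHom s m = stdSimplex.asOrderHom t m) : s = t :=
  stdSimplex.objEquiv.injective (SimplexCategory.Hom.ext _ _ (OrderHom.ext _ _ (funext h)))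

theorem maxSimplex_const_zero {k : SimplexCategoryᵒᵖ} (s : Δ1.{u}.obj k) :
    maxSimplex s (stdSimplex.const 1 0 k) = s :=
  delta1_ext fun _ => max_eq_left (Fin.zero_le _)

theorem maxSimplex_comm {k : SimplexCategoryᵒᵖ} (s t : Δ1.{u}.obj k) :
    maxSimplex s t = maxSimplex t s :=
  delta1_ext fun _ => max_comm _ _

theorem maxSimplex_const_one {k : SimplexCategoryᵒᵖ} (s : Δ1.{u}.obj k) :
    maxSimplex s (stdSimplex.const 1 1 k) = stdSimplex.const 1 1 k :=
  delta1_ext fun _ => max_eq_right (Fin.le_last _)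

/-- The homotopy `(x ∧ s, t) ↦ x ∧ max s t` from the identity of the cone of `X` to the constant
map. -/
def coneContraction (X : SymSpec.{u}) : ParamHom (X.smash interval) Δ1 (X.smash interval) where
  app n k z t := PSSet.smash.lift (fun x s => smash.mk (K := interval) x (maxSimplex s t))
    ((PSSet.smash (X.lvl n) interval).pt k) (fun _ => smash.mk_pt_left _)
    (fun x => (congrArg (smash.mk (K := interval) x)
      ((maxSimplex_comm _ t).trans (maxSimplex_const_one t))).trans (smash.mk_pt_right x)) z
  app_map := by
    rintro n k l θ ⟨x, s⟩ t
    rfl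
  app_pt n k t := smash.mk_pt_left _
  app_act := by
    rintro n π k ⟨x, s⟩ t
    rfl
  app_susp := by
    rintro k n ⟨x, s⟩ t r
    rfl

theorem homotopyRel_cone (X : SymSpec.{u}) :
    HomotopyRel (𝟙 (X.smash interval)) (toPoint _ ≫ fromPoint _) := by
  refine homotopyRel_iff.2 ⟨coneContraction X, hom_ext_apply fun n k => ?_,
    hom_ext_apply fun n k => ?_⟩
  · rintro ⟨x, s⟩
    exact congrArg (smash.mk (K := interval) x) (maxSimplex_const_zero s)
  · rintro ⟨x, s⟩
    exact (congrArg (smash.mk (K := interval) x) (maxSimplex_const_one s)).trans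
      (smash.mk_pt_right x)

theorem isStableEquiv_fromPoint_cone (X : SymSpec.{u}) :
    IsStableEquiv (fromPoint (X.smash interval)) :=
  (isStableEquiv_of_deformation_retract rfl (homotopyRel_cone X)).1

theorem isStableEquiv_toPoint_cone (X : SymSpec.{u}) :
    IsStableEquiv (toPoint (X.smash interval)) :=
  (isStableEquiv_of_deformation_retract rfl (homotopyRel_cone X)).2

theorem isStableEquiv_smashMap_interval (f : X ⟶ Y) : IsStableEquiv (smashMap f interval) :=
  (isStableEquiv_fromPoint_cone X).of_comp_left (by
    rw [eq_fromPoint (fromPoint _ ≫ _)]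
    exact isStableEquiv_fromPoint_cone Y)

theorem isStableEquiv_coneUnionDesc {j : X ⟶ Y} (hj : ∀ n k, Function.Injective (ap j n k))
    (hj' : IsStableEquiv j) : IsStableEquiv (coneUnionDesc j) :=
  (hj'.cobaseChange_of_injective (isPushout_glue j (coneIncl X)) hj).of_comp_left
    (isStableEquiv_smashMap_interval j)

/-! ### Suspensions and cofibers -/

/-- The quotient map `Δ[1] ⟶ S¹`. -/
def intervalToCircle : interval.{u} ⟶ circle.{u} :=
  homMk (fun _ s => Quot.mk _ s) (fun _ _ => rfl)
    (fun _ => Quot.sound ⟨mem_boundary_one_iff.2 ⟨1, rfl⟩, mem_boundary_one_iff.2 ⟨0, rfl⟩⟩)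

theorem ap_smash_mk_eq_pt_of_mem_boundary {p : X.smash interval ⟶ T}
    (h : coneIncl X ≫ p = toPoint X ≫ fromPoint T) (n : ℕ) {k : SimplexCategoryᵒᵖ}
    (x : (X.lvl n).S k) {s : Δ1.{u}.obj k} (hs : s ∈ (boundary.{u} 1).obj k) :
    ap p n k (smash.mk (K := interval) x s) = (T.lvl n).pt k := by
  obtain ⟨ε, rfl⟩ := mem_boundary_one_iff.1 hs
  fin_cases ε
  · exact congr_ap h n k x
  · exact (congrArg (ap p n k) (smash.mk_pt_right x)).trans (PSSet.Hom.app_pt (Hom.lvl p n) k)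

/-- A map out of the suspension, from a map on the cone that is trivial on the base. -/
def suspensionDesc (p : X.smash interval ⟶ T) (h : coneIncl X ≫ p = toPoint X ≫ fromPoint T) :
    suspension X ⟶ T where
  lvl n := homMk (fun k => PSSet.smash.lift
      (fun x => Quot.lift (fun s => ap p n k (smash.mk (K := interval) x s)) fun _ _ hst =>
        (ap_smash_mk_eq_pt_of_mem_boundary h n x hst.1).trans
          (ap_smash_mk_eq_pt_of_mem_boundary h n x hst.2).symm)
      ((T.lvl n).pt k)
      (by
        rintro ⟨s⟩
        exact (congrArg (ap p n k) (smash.mk_pt_left (K := interval) s)).trans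
          (PSSet.Hom.app_pt (Hom.lvl p n) k))
      (fun x => ap_smash_mk_eq_pt_of_mem_boundary h n x (mem_boundary_one_iff.2 ⟨0, rfl⟩)))
    (by
      rintro k l θ ⟨x, ⟨s⟩⟩
      exact PSSet.Hom.ap_map (Hom.lvl p n) θ (smash.mk (K := interval) x s))
    (fun _ => ap_smash_mk_eq_pt_of_mem_boundary h n _ (mem_boundary_one_iff.2 ⟨0, rfl⟩))
  lvl_act := by
    rintro n π k ⟨x, ⟨s⟩⟩
    exact Hom.lvl_act p n π k (smash.mk (K := interval) x s)
  lvl_susp := by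
    rintro k n ⟨x, ⟨s⟩⟩ t
    exact Hom.lvl_susp p k n (smash.mk (K := interval) x s) t

theorem isPushout_suspension (X : SymSpec.{u}) :
    IsPushout (coneIncl X) (toPoint X) (X.smashMapRight intervalToCircle)
      (fromPoint (suspension X)) := by
  have w : coneIncl X ≫ X.smashMapRight intervalToCircle = toPoint X ≫ fromPoint _ :=
    hom_ext_apply fun n k x => smash.mk_pt_right (K := circle) x
  refine IsPushout.of_isColimit' ⟨w⟩ (PushoutCocone.IsColimit.mk _
    (fun s => suspensionDesc s.inl (by rw [s.condition, eq_fromPoint s.inr])) (fun s => ?_)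
    (fun s => (eq_fromPoint _).trans (eq_fromPoint _).symm) (fun s m h _ => ?_))
  · refine hom_ext_apply fun n k => ?_
    rintro ⟨x, t⟩
    rfl
  · refine hom_ext_apply fun n k => ?_
    rintro ⟨x, ⟨t⟩⟩
    exact congr_ap h n k (smash.mk (K := interval) x t)

/-- Collapsing the cone of `Y` in the iterated cofiber `(Y ∪ (X ∧ Δ[1])) ∪ (Y ∧ Δ[1])` leaves the
quotient of `X ∧ Δ[1]` by its base. -/
theorem equivalent_cofiber_inl_suspension (f : X ⟶ Y) :
    Equivalent (cofiber (glue.inl f (coneIncl X))) (suspension X) := by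
  have sq := (isPushout_glue f (coneIncl X)).flip.paste_vert
    (isPushout_glue (glue.inl f (coneIncl X)) (coneIncl Y))
  have sq' : IsPushout (coneIncl X) ((f ≫ coneIncl Y) ≫ toPoint _)
    (X.smashMapRight intervalToCircle) (fromPoint (suspension X)) := isPushout_suspension X
  exact .rel _ _ ⟨_, IsStableEquiv.cobaseChange_along_injective (IsPushout.of_top' sq' sq)
    (glue.inr_injective _ (glue.inl_injective f (coneIncl_injective X)))
    (isStableEquiv_toPoint_cone Y)⟩

theorem isPushout_cofiberMap {f : X ⟶ Y} {g : Y ⟶ Z} {h : X ⟶ Z} (w : f ≫ g = 𝟙 X ≫ h) :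
    IsPushout g (glue.inl f (coneIncl X)) (glue.inl h (coneIncl X)) (cofiberMap f h (𝟙 X) g w) := by
  obtain rfl : f ≫ g = h := w.trans (Category.id_comp h)
  refine IsPushout.of_left ?_ rfl (isPushout_glue f (coneIncl X))
  have e : glue.inr f (coneIncl X) ≫ cofiberMap f (f ≫ g) (𝟙 X) g w = glue.inr _ _ :=
    hom_ext_apply fun n k => by
      rintro ⟨x, s⟩
      rfl
  rw [e]
  exact isPushout_glue (f ≫ g) (coneIncl X)

theorem IsStableEquiv.cofiberMap_id_left {f : X ⟶ Y} {g : Y ⟶ Z} {h : X ⟶ Z}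
    (w : f ≫ g = 𝟙 X ≫ h) (hg : IsStableEquiv g) : IsStableEquiv (cofiberMap f h (𝟙 X) g w) :=
  hg.cobaseChange_along_injective (isPushout_cofiberMap w).flip
    (glue.inl_injective f (coneIncl_injective X))

/-- The cofiber of `h` is `Y ∪_W (W ∧ Δ[1])`, which is also the pushout of `Y` and
`X ∪_W (W ∧ Δ[1])` over `X`. -/
theorem isPushout_coneUnionDesc {j : W ⟶ X} {g : X ⟶ Y} {h : W ⟶ Y} (w : j ≫ g = h) :
    IsPushout (coneUnionDesc j) (cofiberMap j h (𝟙 W) g (w.trans (Category.id_comp h).symm))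
      (glue.inr g (coneIncl X))
      (cofiberMap h g j (𝟙 Y) ((Category.comp_id h).trans w.symm)) := by
  refine IsPushout.of_left (isPushout_glue g (coneIncl X)).flip (glue.hom_ext ?_ ?_)
    (isPushout_cofiberMap (w.trans (Category.id_comp h).symm)).flip
  · exact (glue.condition g (coneIncl X)).symm
  · refine hom_ext_apply fun n k => ?_
    rintro ⟨x, s⟩
    rfl

theorem IsStableEquiv.cofiberMap_id_right {j : W ⟶ X} {g : X ⟶ Y} {h : W ⟶ Y} (w : h ≫ 𝟙 Y = j ≫ g)
    (hj : ∀ n k, Function.Injective (ap j n k)) (hj' : IsStableEquiv j) :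
    IsStableEquiv (cofiberMap h g j (𝟙 Y) w) :=
  (isStableEquiv_coneUnionDesc hj hj').cobaseChange_of_injective
    (isPushout_coneUnionDesc (w.symm.trans (Category.comp_id h)))
    (coneUnionDesc_injective hj)

theorem isStableEquiv_inr_comp_inl_cofiber (X Y : SymSpec.{u}) :
    IsStableEquiv (glue.inr (fromPoint X) (fromPoint Y) ≫
      glue.inl (glue.inl _ _ : X ⟶ wedge X Y) (coneIncl X)) := by
  have sq := (isPushout_glue (fromPoint X) (fromPoint Y)).flip.paste_vert
    (isPushout_glue (glue.inl _ _) (coneIncl X))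
  rw [eq_fromPoint (fromPoint X ≫ coneIncl X)] at sq
  exact (isStableEquiv_fromPoint_cone X).cobaseChange_of_injective sq.flip fun _ _ _ _ _ => rfl

/-- The homotopy cofiber of `f` is equivalent to that of `X ⟶ X ∨ Y`, hence to `Y`. -/
theorem isStableEquiv_comp_inl_cofiber {f : X ⟶ Z} {s : Y ⟶ Z}
    (h : IsStableEquiv (wedgeDesc f s)) : IsStableEquiv (s ≫ glue.inl f (coneIncl X)) :=
  (isStableEquiv_inr_comp_inl_cofiber X Y).comp (h.cofiberMap_id_left (Category.id_comp f).symm)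

end SymSpec

end

theorem lemma5p1 {M₀₀ M₀₁ M₁₀ M₁₁ : SymSpec.{u}}
    (α : M₀₀ ⟶ M₀₁) (β : M₀₀ ⟶ M₁₀) (γ : M₁₀ ⟶ M₁₁) (δ : M₀₁ ⟶ M₁₁)
    (comm : β ≫ γ = α ≫ δ)
    (s : M₁₁ ⟶ M₁₀) (hs : s ≫ γ = 𝟙 M₁₁)
    (hβs : SymSpec.IsStableEquiv (SymSpec.wedgeDesc β s)) :
    SymSpec.Equivalent (SymSpec.cofiber₂ α β γ δ comm) (SymSpec.suspension M₀₁) := by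
  let j : M₁₁ ⟶ SymSpec.cofiber β := s ≫ SymSpec.glue.inl β (SymSpec.coneIncl M₀₀)
  have hj : SymSpec.IsStableEquiv j := SymSpec.isStableEquiv_comp_inl_cofiber hβs
  have hj_injective (n k) : Function.Injective (SymSpec.ap j n k) :=
    (SymSpec.glue.inl_injective β (SymSpec.coneIncl_injective M₀₀) n k).comp
      (Function.LeftInverse.injective (g := SymSpec.ap γ n k) (SymSpec.congr_ap hs n k))
  have hjc : j ≫ SymSpec.cofiberMap β δ α γ comm = SymSpec.glue.inl δ (SymSpec.coneIncl M₀₁) :=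
    congrArg (· ≫ SymSpec.glue.inl δ (SymSpec.coneIncl M₀₁)) hs
  have hC₂ : SymSpec.Equivalent (SymSpec.cofiber (SymSpec.glue.inl δ (SymSpec.coneIncl M₀₁)))
      (SymSpec.cofiber₂ α β γ δ comm) :=
    .rel _ _ ⟨_, hj.cofiberMap_id_right ((Category.comp_id _).trans hjc.symm) hj_injective⟩
  exact .trans _ _ _ (.symm _ _ hC₂) (SymSpec.equivalent_cofiber_inl_suspension δ)
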